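/- **Setting.** Let $p\in(1/2,1]$, let $g:\mathbb N\to[0,\infty)$ be nondecreasing with $g(0)=0<g(1)\le\lim_{n\to\infty}g(n)=1$, and let $\alpha:\mathbb Z\to[0,1]$. On a probability space $(\Omega,\mathcal F,\mathbb P)$ let $\omega=\sum_n\delta_{(T_n,X_n,U_n,Z_n)}$ be a Poisson random measure on $(0,\infty)\times\mathbb Z\times(0,1)\times\{-1,1\}$ whose intensity is the product of Lebesgue measure on $(0,\infty)$, counting measure on $\mathbb Z$, Lebesgue measure on $(0,1)$ and the law giving mass $p$ to $1$ and $1-p$ to $-1$. For $\eta_0\in\mathbb N^{\mathbb Z}$, the zero-range process $(\eta^\alpha_s)_{s\ge0}$ driven by $\omega$ is the càdlàg path in $\mathbb N^{\mathbb Z}$ started from $\eta_0$ such that: at each point $(s,x,v,z)$ of $\omega$, $\eta^\alpha_s=\eta^\alpha_{s-}-\delta_x+\delta_{x+z}$ if $v\le\alpha(x)g(\eta^\alpha_{s-}(x))$, and $\eta^\alpha_s=\eta^\alpha_{s-}$ otherwise; and $\eta^\alpha_\cdot(x)$ is constant on every time interval during which $\omega$ has no point $(\tau,y,v,z)$ with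 $x\in\{y,y+z\}$. Almost surely, this path exists and is unique for all $\eta_0$ simultaneously. Let $(\xi^{\alpha,r}_0)_{r\in[0,\infty)}$ be random elements of $\mathbb N^{\mathbb Z}$ such that almost surely $\xi_0^{\alpha,r}\le\xi_0^{\alpha,r'}$ whenever $0\le r\le r'$, and such that, for each $r$, $n^{-1}\sum_{x=-n}^0\xi_0^{\alpha,r}(x)\to r$ and $n^{-1}\sum_{x=0}^n\xi_0^{\alpha,r}(x)\to r$ in probability. Let $0\le\lambda\le\rho<\infty$, $u\in\mathbb R$, $t\ge0$, and $$\eta_0^{\alpha,\lambda,\rho,t}(x)=\xi_0^{\alpha,\lambda}(x)\mathbf 1_{\{x\le\lfloor ut\rfloor\}}+\xi_0^{\alpha,\rho}(x)\mathbf 1_{\{x>\lfloor ut\rfloor\}}.$$ Let $\xi^{\alpha,r}_s$ and $\eta^{\alpha,\lambda,\rho,t}_s$ be the processes with these initial configurations, all driven by the same $\omega$. **Proposition.** There exists a family of $\mathbb Z$-valued processes $(\mathcal X^{\alpha,r,t}_s)_{s\ge0}$, $r\in[\lambda,\rho]$, on $\Omega$ such that, almost surely, $\mathcal X_0^{\alpha,r,t}=\lfloor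 ut\rfloor$ for all $r\in[\lambda,\rho]$ and the following hold. (i) For every $r\in[\lambda,\rho]$ and $s\ge0$, $\eta_s^{\alpha,\lambda,\rho,t}(y)\le\xi_s^{\alpha,r}(y)$ for all $y\le\mathcal X_s^{\alpha,r,t}$, and $\eta_s^{\alpha,\lambda,\rho,t}(y)\ge\xi_s^{\alpha,r}(y)$ for all $y>\mathcal X_s^{\alpha,r,t}$. (ii) For every $r\in[\lambda,\rho]$, $s\mapsto\mathcal X_s^{\alpha,r,t}$ is piecewise constant and càdlàg with nearest-neighbour jumps. (iii) For all $r\le r'$ in $[\lambda,\rho]$ and all $s\ge0$, $\mathcal X_s^{\alpha,r,t}\le\mathcal X_s^{\alpha,r',t}$. (iv) Moreover, for every $r\in[\lambda,\rho]$ there exist Poisson processes $\mathcal N^{\pm,r,t}$ of intensity $1$ on $\Omega$, started at $0$, such that almost surely, for all $s\ge0$, $$-\mathcal N_s^{-,r,t}\le\mathcal X_s^{\alpha,r,t}-\mathcal X_0^{\alpha,r,t}\le\mathcal N_s^{+,r,t}.$$ -/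

import Mathlib

open MeasureTheory ProbabilityTheory Filter Topology
open scoped NNReal ENNReal

noncomputable section

namespace ZeroRange

/-! ### Paths -/

/-- A path on `[0, ∞)` is càdlàg: right-continuous, with a left limit at every time
(at time `0` the filter `𝓝[<] 0` is trivial, so nothing is required there). -/
def IsCadlag {E : Type*} [TopologicalSpace E] (x : ℝ≥0 → E) : Prop :=
  ∀ s, ContinuousWithinAt x (Set.Ici s) s ∧ ∃ l, Tendsto x (𝓝[<] s) (𝓝 l)

/-- A piecewise constant càdlàg `ℤ`-valued path with nearest-neighbour jumps. Here
`Function.leftLim x s` is `x_{s-}` (and `x_0` for `s = 0`). -/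
structure IsNearestNeighbourPath (x : ℝ≥0 → ℤ) : Prop where
  cadlag : IsCadlag x
  finite_jumps : ∀ T : ℝ≥0, {s : ℝ≥0 | s ≤ T ∧ x s ≠ Function.leftLim x s}.Finite
  nearest : ∀ s, |x s - Function.leftLim x s| ≤ 1

/-! ### Poisson random measures, Harris systems, Poisson processes -/

section Poisson

variable {Ω : Type*} [MeasurableSpace Ω]

/-- `M` is a Poisson random measure with intensity `m`: the masses of sets of finite intensity
have Poisson distributions, and the masses of disjoint sets are independent. -/
structure IsPoissonRandomMeasure {E : Type*} [MeasurableSpace E]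
    (M : Ω → Measure E) (m : Measure E) (P : Measure Ω) : Prop where
  measurable : Measurable M
  law : ∀ B : Set E, MeasurableSet B → m B ≠ ∞ →
    P.map (fun ω => M ω B) = (poissonMeasure (m B).toNNReal).map (fun k : ℕ => (k : ℝ≥0∞))
  indep : ∀ (n : ℕ) (B : Fin n → Set E), (∀ i, MeasurableSet (B i)) →
    Pairwise (fun i j => Disjoint (B i) (B j)) → iIndepFun (fun i ω => M ω (B i)) P

/-- A potential jump event `(s, x, v, z)`: time, site, uniform mark and direction. -/
abbrev Event : Type := ℝ × ℤ × ℝ × ℤ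

/-- The intensity `ds dx 1_{(0,1)}(v) dv p(z) dz` on `(0, ∞) × ℤ × (0, 1) × {-1, 1}`, where
`p(1) = p` and `p(-1) = 1 - p`. -/
def harrisIntensity (p : ℝ) : Measure Event :=
  (volume.restrict (Set.Ioi (0 : ℝ))).prod
    ((Measure.count : Measure ℤ).prod
      ((volume.restrict (Set.Ioo (0 : ℝ) 1)).prod
        (ENNReal.ofReal p • Measure.dirac (1 : ℤ) +
          ENNReal.ofReal (1 - p) • Measure.dirac (-1 : ℤ))))

/-- A Harris system: random points `e n = (T_n, X_n, U_n, Z_n)` such that `∑ n, δ_{e n}` is a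
Poisson random measure with intensity `harrisIntensity p`. -/
structure IsHarrisSystem (p : ℝ) (e : ℕ → Ω → Event) (P : Measure Ω) : Prop where
  measurable : ∀ n, Measurable (e n)
  mem : ∀ n ω, 0 < (e n ω).1 ∧ (e n ω).2.2.1 ∈ Set.Ioo (0 : ℝ) 1 ∧
    ((e n ω).2.2.2 = -1 ∨ (e n ω).2.2.2 = 1)
  poisson : IsPoissonRandomMeasure
    (fun ω => Measure.sum fun n => Measure.dirac (e n ω)) (harrisIntensity p) P

/-- The set of potential jump events of the realization `ω`. -/
def events (e : ℕ → Ω → Event) (ω : Ω) : Set Event := Set.range fun n => e n ω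

/-- A (homogeneous) Poisson counting process with the given rate, started at `0`. -/
structure IsPoissonProcess (N : ℝ≥0 → Ω → ℕ) (rate : ℝ≥0) (P : Measure Ω) : Prop where
  measurable : ∀ s, Measurable (N s)
  zero : ∀ᵐ ω ∂P, N 0 ω = 0
  monotone : ∀ᵐ ω ∂P, Monotone fun s => N s ω
  cadlag : ∀ᵐ ω ∂P, IsCadlag fun s => N s ω
  indep : HasIndepIncrements N P
  law : ∀ s s' : ℝ≥0, s ≤ s' →
    P.map (fun ω => N s' ω - N s ω) = poissonMeasure (rate * (s' - s))

end Poisson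

/-! ### The zero-range process in a site-disordered environment -/

/-- Particle configurations with finitely many particles per site. -/
abbrev Config : Type := ℤ → ℕ

/-- Assumptions on the jump rate: nondecreasing, `g 0 = 0 < g 1`, and `g n → 1`. -/
structure IsJumpRate (g : ℕ → ℝ) : Prop where
  monotone : Monotone g
  zero : g 0 = 0
  one_pos : 0 < g 1
  tendsto : Tendsto g atTop (𝓝 1)

/-- `η^{x,y} = η - δ_x + δ_y`; only used when `η x > 0`. -/
def move (η : Config) (x y : ℤ) : Config := fun w =>
  η w - (if w = x then 1 else 0) + (if w = y then 1 else 0)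

/-- `η` is the càdlàg evolution from `η₀` driven by the set `S` of potential jump events: at an
event `(s, x, v, z)` a particle jumps from `x` to `x + z` if `v ≤ α(x) g(η_{s-}(x))`, and nothing
happens otherwise; the occupation number of a site does not change during a time interval
without events that involve this site. -/
structure IsHarrisPath (α : ℤ → ℝ) (g : ℕ → ℝ) (S : Set Event) (η₀ : Config)
    (η : ℝ≥0 → Config) : Prop where
  init : η 0 = η₀
  cadlag : IsCadlag η
  at_event : ∀ (s : ℝ≥0) (x : ℤ) (v : ℝ) (z : ℤ), ((s : ℝ), x, v, z) ∈ S →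
    η s = if v ≤ α x * g (Function.leftLim η s x)
      then move (Function.leftLim η s) x (x + z) else Function.leftLim η s
  no_event : ∀ (x : ℤ) (s s' : ℝ≥0), s ≤ s' →
    (∀ (τ : ℝ≥0) (y : ℤ) (v : ℝ) (z : ℤ), ((τ : ℝ), y, v, z) ∈ S → s < τ → τ ≤ s' →
      x ≠ y ∧ x ≠ y + z) →
    ∀ τ : ℝ≥0, s < τ → τ ≤ s' → η τ x = η s x

open Classical in
/-- The flow `(η₀, s) ↦ η_s(α, η₀, S)`: the evolution from `η₀` driven by `S`
(constant in the exceptional case that there is none). -/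
def flow (α : ℤ → ℝ) (g : ℕ → ℝ) (S : Set Event) (η₀ : Config) : ℝ≥0 → Config :=
  if h : ∃ η, IsHarrisPath α g S η₀ η then h.choose else fun _ => η₀

/-! ### (Pseudo-)equilibria, Riemann data, interfaces -/

/-- An ordered family of random configurations `ξ₀ r`, `r ∈ [0, ∞)`, such that `ξ₀ r` has
asymptotic density `r` to the left and to the right, in probability. -/
structure IsPseudoEquilibriumFamily {Ω : Type*} [MeasurableSpace Ω]
    (ξ₀ : ℝ≥0 → Ω → Config) (P : Measure Ω) : Prop where
  measurable : ∀ r, Measurable (ξ₀ r)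
  ordered : ∀ᵐ ω ∂P, ∀ r r' : ℝ≥0, r ≤ r' → ξ₀ r ω ≤ ξ₀ r' ω
  density_left : ∀ r : ℝ≥0, TendstoInMeasure P
    (fun (n : ℕ) ω => (n : ℝ)⁻¹ * ∑ x ∈ Finset.Icc (-(n : ℤ)) 0, (ξ₀ r ω x : ℝ))
    atTop (fun _ => (r : ℝ))
  density_right : ∀ r : ℝ≥0, TendstoInMeasure P
    (fun (n : ℕ) ω => (n : ℝ)⁻¹ * ∑ x ∈ Finset.Icc 0 (n : ℤ), (ξ₀ r ω x : ℝ))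
    atTop (fun _ => (r : ℝ))

/-- The Riemann configuration that equals `ξl` on sites `≤ a` and `ξr` on sites `> a`. -/
def riemannConfig (ξl ξr : Config) (a : ℤ) : Config := fun x => if x ≤ a then ξl x else ξr x

/-- The position `x` is an interface between `η` and `ξ`: `η ≤ ξ` on sites `≤ x`
and `η ≥ ξ` on sites `> x`. -/
def IsInterface (η ξ : Config) (x : ℤ) : Prop :=
  (∀ y ≤ x, η y ≤ ξ y) ∧ ∀ y > x, ξ y ≤ η y

end ZeroRange

end

/-! The order relation needed is preserved event by event, so the work lies in reducing the infinite
system to finite lists of events. Almost surely (`ae_isRegular`) event times are distinct, each bond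
carries finitely many events in bounded time, and arbitrarily far on both sides there are bonds
without events up to time `T`. Two such bonds `A`, `B` isolate a block whose evolution up to `T` is
a finite composition of updates. Hence the run of the first `n` events, sorted by time, stabilizes
on every block (`run_stabilizes`). Its limit is the unique Harris path, and a relation preserved by
every single update passes to the limit.

The interface is carried along as a third coordinate of the state (`interfaceStep`): it moves only
at an event on its own bond `{X, X + 1}`, and only when the order would fail otherwise.
Attractiveness (`jump_cases`: if just one of two processes jumps, it has strictly more particles at
the departure site) makes the moved position an interface again (`isInterface_interfaceStep`). The
rule is monotone in the second configuration (`interfaceStep_le`), which orders the interfaces in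
`r`. All `r` share one exceptional null set, because regularity does not involve `r` and the initial
order holds for all densities at once.

The interface lies between the two walks that step by `1` or by `-1` at every event on their current
bond. Each bond is crossed at total rate `p + (1 - p) = 1`. A walk reads off a new bond after each
step, but its choice depends only on the past, so its step count is a rate-one Poisson process. The
proof uses a time grid: a walk that reads its bond only at the start of each slot has exactly
independent Poisson step numbers (`map_gridStep`), and it coincides with the true walk at the
prescribed times once the grid separates the finitely many events of a block
(`eventually_gridWalk_eq`). -/

noncomputable section

namespace ZeroRange

/-! ### Event lists and their execution -/

/-- The bond `{b, b + 1}` crossed by a potential jump is denoted by its left end `b`. -/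
def bond (E : Event) : ℤ := if E.2.2.2 = 1 then E.2.1 else E.2.1 - 1

/-- Positive time, mark in `(0, 1)` and direction `±1`. -/
def IsValid (E : Event) : Prop :=
  0 < E.1 ∧ E.2.2.1 ∈ Set.Ioo (0 : ℝ) 1 ∧ (E.2.2.2 = -1 ∨ E.2.2.2 = 1)

/-- Deterministic properties that almost every realization of a Harris system has. -/
structure IsRegular (ev : ℕ → Event) : Prop where
  valid : ∀ i, IsValid (ev i)
  inj : ∀ i j, (ev i).1 = (ev j).1 → i = j
  finite : ∀ (b : ℤ) (T : ℝ), {i | bond (ev i) = b ∧ (ev i).1 ≤ T}.Finite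
  right : ∀ (T : ℝ) (k : ℤ), ∃ b ≥ k, ∀ i, (ev i).1 ≤ T → bond (ev i) ≠ b
  left : ∀ (T : ℝ) (k : ℤ), ∃ b ≤ k, ∀ i, (ev i).1 ≤ T → bond (ev i) ≠ b

/-- The labels `0, …, n - 1`, sorted by the times of their events. -/
def labels (ev : ℕ → Event) : ℕ → List ℕ
  | 0 => []
  | n + 1 => (labels ev n).orderedInsert (fun i j => (ev i).1 ≤ (ev j).1) n

theorem labels_perm (ev : ℕ → Event) (n : ℕ) : (labels ev n).Perm (List.range n) := by
  induction n with
  | zero => simp [labels]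
  | succ n ih =>
    refine (List.perm_orderedInsert _ _ _).trans ?_
    rw [List.range_succ]
    exact (ih.cons n).trans (List.perm_append_singleton _ _).symm

theorem mem_labels {ev : ℕ → Event} {n i : ℕ} : i ∈ labels ev n ↔ i < n := by
  rw [(labels_perm ev n).mem_iff, List.mem_range]

theorem labels_nodup (ev : ℕ → Event) (n : ℕ) : (labels ev n).Nodup :=
  (labels_perm ev n).nodup_iff.2 List.nodup_range

theorem labels_pairwise (ev : ℕ → Event) (n : ℕ) :
    (labels ev n).Pairwise (fun i j => (ev i).1 ≤ (ev j).1) := by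
  induction n with
  | zero => simp [labels]
  | succ n ih =>
    have : Std.Total (fun i j => (ev i).1 ≤ (ev j).1) := ⟨fun i j => le_total _ _⟩
    have : IsTrans ℕ (fun i j => (ev i).1 ≤ (ev j).1) := ⟨fun i j k => le_trans⟩
    exact ih.orderedInsert _ _

/-- Apply the updates `U (ev i)` for the labels `i` in `l` whose events occur up to time `s`. -/
def run {σ : Type*} (U : Event → σ → σ) (ev : ℕ → Event) (l : List ℕ) (s : ℝ) (x : σ) : σ :=
  (l.filter (fun i => (ev i).1 ≤ s)).foldl (fun x i => U (ev i) x) x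

section Run

variable {σ : Type*} {U : Event → σ → σ} {ev : ℕ → Event} {l : List ℕ}

theorem run_cons (i : ℕ) (s : ℝ) (x : σ) :
    run U ev (i :: l) s x = run U ev l s (if (ev i).1 ≤ s then U (ev i) x else x) := by
  by_cases h : (ev i).1 ≤ s <;> simp [run, h]

theorem run_induction {s : ℝ} (p : σ → Prop) (hp : ∀ i ∈ l, (ev i).1 ≤ s → ∀ x, p x → p (U (ev i) x))
    {x : σ} (hx : p x) : p (run U ev l s x) := by
  induction l generalizing x with
  | nil => exact hx
  | cons i l ih =>
    rw [run_cons]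
    refine ih (fun j hj => hp j (List.mem_cons_of_mem _ hj)) ?_
    split_ifs with h
    · exact hp i List.mem_cons_self h x hx
    · exact hx

theorem run_induction₂ {σ' : Type*} {U' : Event → σ' → σ'} {s : ℝ} (p : σ → σ' → Prop)
    (hp : ∀ i ∈ l, (ev i).1 ≤ s → ∀ x y, p x y → p (U (ev i) x) (U' (ev i) y))
    {x : σ} {y : σ'} (hx : p x y) : p (run U ev l s x) (run U' ev l s y) := by
  induction l generalizing x y with
  | nil => exact hx
  | cons i l ih =>
    rw [run_cons, run_cons]
    refine ih (fun j hj => hp j (List.mem_cons_of_mem _ hj)) ?_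
    split_ifs with h
    · exact hp i List.mem_cons_self h x y hx
    · exact hx

/-- In a time-sorted list the events up to `s` form an initial segment. This is the flow property: a
run up to `t` continues the run up to `s`. -/
theorem run_split (hl : l.Pairwise (fun i j => (ev i).1 ≤ (ev j).1)) {s t : ℝ} (hst : s ≤ t)
    (x : σ) : run U ev l t x = run U ev (l.filter (fun i => s < (ev i).1)) t (run U ev l s x) := by
  induction l generalizing x with
  | nil => rfl
  | cons i l ih =>
    rw [List.pairwise_cons] at hl
    by_cases h : (ev i).1 ≤ s
    · have h' : ¬ s < (ev i).1 := not_lt.2 h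
      rw [run_cons, run_cons, ih hl.2]
      simp [h, h', h.trans hst]
    · have h' : s < (ev i).1 := not_le.1 h
      have e1 : run U ev (i :: l) s x = x := by
        have : (i :: l).filter (fun i => (ev i).1 ≤ s) = [] := by
          simp only [List.filter_eq_nil_iff, List.mem_cons, forall_eq_or_imp, decide_eq_true_eq]
          exact ⟨h, fun j hj hjs => h ((hl.1 j hj).trans hjs)⟩
        simp only [run, this, List.foldl_nil]
      have e2 : (i :: l).filter (fun i => s < (ev i).1) = i :: l := by
        simp only [List.filter_eq_self, List.mem_cons, forall_eq_or_imp, decide_eq_true_eq]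
        exact ⟨h', fun j hj => h'.trans_le (hl.1 j hj)⟩
      rw [e1, e2]

theorem run_eq_of_forall_not {s t : ℝ} (hl : l.Pairwise (fun i j => (ev i).1 ≤ (ev j).1))
    (hst : s ≤ t) (h : ∀ i ∈ l, s < (ev i).1 → ¬ (ev i).1 ≤ t) (x : σ) :
    run U ev l t x = run U ev l s x := by
  rw [run_split hl hst, run]
  have : (l.filter (fun i => s < (ev i).1)).filter (fun i => (ev i).1 ≤ t) = [] := by
    simp only [List.filter_eq_nil_iff, List.mem_filter, decide_eq_true_eq]
    exact fun i hi => h i hi.1 hi.2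
  rw [this, List.foldl_nil]

theorem run_eq_update {s : ℝ} {i : ℕ} (hl : l.Pairwise (fun i j => (ev i).1 ≤ (ev j).1))
    (hn : l.Nodup) (hi : i ∈ l) (hsi : s < (ev i).1)
    (h : ∀ j ∈ l, s < (ev j).1 → (ev j).1 ≤ (ev i).1 → j = i) (x : σ) :
    run U ev l (ev i).1 x = U (ev i) (run U ev l s x) := by
  rw [run_split hl hsi.le, run]
  have : (l.filter (fun j => s < (ev j).1)).filter (fun j => (ev j).1 ≤ (ev i).1) = [i] := by
    rw [← List.perm_singleton]
    refine (List.perm_ext_iff_of_nodup ((hn.filter _).filter _) (List.nodup_singleton i)).2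
      fun j => ?_
    simp only [List.mem_filter, decide_eq_true_eq, List.mem_singleton]
    constructor
    · exact fun hj => h j hj.1.1 hj.1.2 hj.2
    · rintro rfl
      exact ⟨⟨hi, hsi⟩, le_rfl⟩
  rw [this]
  rfl

/-! ### Localization to finite space-time blocks -/

/-- Updates at bonds strictly between `A` and `B` respect the (partial) equivalence relation `R`,
and updates at bonds outside of `[A, B]` are not seen by it. -/
structure IsLocal (U : Event → σ → σ) (R : σ → σ → Prop) (A B : ℤ) : Prop where
  inner : ∀ E, IsValid E → A < bond E → bond E < B → ∀ x y, R x y → R (U E x) (U E y)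
  outer : ∀ E, IsValid E → (bond E < A ∨ B < bond E) → ∀ x y, R x y → R (U E x) y

/-- No potential jump crosses the bonds `A` and `B` up to time `T`. -/
def IsBlock (ev : ℕ → Event) (T : ℝ) (A B : ℤ) : Prop :=
  ∀ i, (ev i).1 ≤ T → bond (ev i) ≠ A ∧ bond (ev i) ≠ B

theorem IsRegular.exists_block (h : IsRegular ev) (T : ℝ) (k m : ℤ) :
    ∃ A B, A ≤ k ∧ m ≤ B ∧ IsBlock ev T A B := by
  obtain ⟨A, hA, hA'⟩ := h.left T k
  obtain ⟨B, hB, hB'⟩ := h.right T m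
  exact ⟨A, B, hA, hB, fun i hi => ⟨hA' i hi, hB' i hi⟩⟩

/-- `l` is the time-ordered list of the labels of all events strictly inside the block, up to
time `T`. -/
structure IsBlockList (ev : ℕ → Event) (T : ℝ) (A B : ℤ) (l : List ℕ) : Prop where
  nodup : l.Nodup
  pairwise : l.Pairwise (fun i j => (ev i).1 ≤ (ev j).1)
  mem_iff : ∀ i, i ∈ l ↔ (A < bond (ev i) ∧ bond (ev i) < B) ∧ (ev i).1 ≤ T

/-- Two sorted enumerations of one set differ only in the order of ties, and distinct event times
leave no ties. -/
theorem IsBlockList.unique (h : IsRegular ev) {T : ℝ} {A B : ℤ} {l l' : List ℕ}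
    (hl : IsBlockList ev T A B l) (hl' : IsBlockList ev T A B l') : l = l' := by
  refine List.Perm.eq_of_pairwise (le := fun i j => (ev i).1 ≤ (ev j).1)
    (fun a b _ _ h1 h2 => h.inj _ _ (le_antisymm h1 h2)) hl.pairwise hl'.pairwise ?_
  refine (List.perm_ext_iff_of_nodup hl.nodup hl'.nodup).2 fun i => ?_
  rw [hl.mem_iff, hl'.mem_iff]

/-- A block has finitely many inner bonds, each with finitely many events up to `T`. Once `n`
exceeds all their labels, the sorted list restricted to the block no longer changes. -/
theorem IsRegular.exists_isBlockList (h : IsRegular ev) (T : ℝ) (A B : ℤ) :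
    ∃ l, IsBlockList ev T A B l ∧ ∃ n₀, ∀ n ≥ n₀, (labels ev n).filter
      (fun i => (A < bond (ev i) ∧ bond (ev i) < B) ∧ (ev i).1 ≤ T) = l := by
  have hfin : {i | (A < bond (ev i) ∧ bond (ev i) < B) ∧ (ev i).1 ≤ T}.Finite := by
    refine ((Set.finite_Ioo A B).biUnion (fun b _ => h.finite b T)).subset fun i hi => ?_
    simp only [Set.mem_iUnion]
    exact ⟨_, ⟨hi.1.1, hi.1.2⟩, rfl, hi.2⟩
  obtain ⟨N, hN⟩ := hfin.bddAbove
  have key : ∀ n ≥ N + 1, IsBlockList ev T A B ((labels ev n).filter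
      (fun i => (A < bond (ev i) ∧ bond (ev i) < B) ∧ (ev i).1 ≤ T)) := by
    refine fun n hn => ⟨(labels_nodup ev n).filter _, (labels_pairwise ev n).filter _,
      fun i => ?_⟩
    simp only [List.mem_filter, mem_labels, decide_eq_true_eq, and_iff_right_iff_imp]
    exact fun hi => (Nat.lt_succ_of_le (hN hi)).trans_le hn
  exact ⟨_, key (N + 1) le_rfl, N + 1, fun n hn => (key n hn).unique h (key _ le_rfl)⟩

/-- An event discarded by the filter and occurring by time `s` lies strictly outside the block,
since the boundary bonds are silent. It therefore acts on the left state only, and `R` ignores it.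
-/
theorem run_filter_related {R : σ → σ → Prop} {A B : ℤ} (hU : IsLocal U R A B)
    (hv : ∀ i, IsValid (ev i)) {T : ℝ} (hb : IsBlock ev T A B) {s : ℝ} (hs : s ≤ T)
    {x y : σ} (hxy : R x y) :
    R (run U ev l s x) (run U ev (l.filter
      (fun i => (A < bond (ev i) ∧ bond (ev i) < B) ∧ (ev i).1 ≤ T)) s y) := by
  induction l generalizing x y with
  | nil => exact hxy
  | cons i l ih =>
    by_cases his : (ev i).1 ≤ s
    · by_cases hi : A < bond (ev i) ∧ bond (ev i) < B
      · rw [List.filter_cons_of_pos (by simpa using ⟨hi, his.trans hs⟩), run_cons, run_cons,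
          if_pos his, if_pos his]
        exact ih (hU.inner _ (hv i) hi.1 hi.2 _ _ hxy)
      · rw [List.filter_cons_of_neg (by simp; intro a b; exact absurd ⟨a, b⟩ hi), run_cons,
          if_pos his]
        have := hb i (his.trans hs)
        exact ih (hU.outer _ (hv i) (by omega) _ _ hxy)
    · rw [run_cons, if_neg his, List.filter_cons]
      split_ifs
      · rw [run_cons, if_neg his]
        exact ih hxy
      · exact ih hxy

theorem IsRegular.run_stabilizes (h : IsRegular ev) {T : ℝ} {A B : ℤ} (hb : IsBlock ev T A B)
    {l : List ℕ} (hl : IsBlockList ev T A B l) :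
    ∃ n₀, ∀ n ≥ n₀, ∀ s ≤ T, ∀ (σ : Type*) (U : Event → σ → σ) (R : σ → σ → Prop),
      IsLocal U R A B → ∀ x, R x x → R (run U ev (labels ev n) s x) (run U ev l s x) := by
  obtain ⟨l', hl', n₀, hn₀⟩ := h.exists_isBlockList T A B
  obtain rfl := hl'.unique h hl
  refine ⟨n₀, fun n hn s hs σ U R hU x hx => ?_⟩
  rw [← hn₀ n hn]
  exact run_filter_related hU h.valid hb hs hx

end Run

/-! ### Piecewise constant paths -/

section Paths

variable {E : Type*}

/-- On every compact time interval, `f` changes at finitely many times only, and is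
right-continuous there. -/
def IsPiecewiseConst (f : ℝ≥0 → E) : Prop :=
  ∀ T : ℝ≥0, ∃ F : Set ℝ≥0, F.Finite ∧
    ∀ s s', s ≤ s' → s' ≤ T → (∀ φ ∈ F, s < φ → ¬ φ ≤ s') → f s' = f s

theorem IsPiecewiseConst.comp {E' : Type*} {f : ℝ≥0 → E} (h : IsPiecewiseConst f) (φ : E → E') :
    IsPiecewiseConst (fun s => φ (f s)) := fun T => by
  obtain ⟨F, hF, h⟩ := h T
  exact ⟨F, hF, fun s s' h1 h2 h3 => congrArg φ (h s s' h1 h2 h3)⟩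

theorem IsPiecewiseConst.eventually_right {f : ℝ≥0 → E} (h : IsPiecewiseConst f) (s : ℝ≥0) :
    ∀ᶠ τ in 𝓝[≥] s, f τ = f s := by
  obtain ⟨F, hF, h⟩ := h (s + 1)
  have h1 : ∀ᶠ τ in 𝓝[≥] s, ∀ φ ∈ F, s < φ → ¬ φ ≤ τ := by
    refine (eventually_all_finite hF).2 fun φ _ => ?_
    by_cases hs : s < φ
    · filter_upwards [nhdsWithin_le_nhds (Iio_mem_nhds hs)] with τ hτ _
      exact not_le.2 hτ
    · exact Eventually.of_forall fun _ h => absurd h hs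
  have h2 : ∀ᶠ τ in 𝓝[≥] s, τ ≤ s + 1 :=
    nhdsWithin_le_nhds (Iic_mem_nhds (lt_add_of_pos_right s one_pos))
  filter_upwards [h1, h2, self_mem_nhdsWithin] with τ h1 h2 h3
  exact h s τ h3 h2 h1

theorem eventually_forall_finite_not_mem_Ioo {F : Set ℝ≥0} (hF : F.Finite) (s : ℝ≥0) :
    ∀ᶠ τ in 𝓝[<] s, ∀ φ ∈ F, φ < s → φ ≤ τ := by
  refine (eventually_all_finite hF).2 fun φ _ => ?_
  by_cases hs : φ < s
  · filter_upwards [nhdsWithin_le_nhds (Ioi_mem_nhds hs)] with τ hτ _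
    exact hτ.le
  · exact Eventually.of_forall fun _ h => absurd h hs

theorem nhdsLT_neBot_of_pos {s : ℝ≥0} (hs : 0 < s) : (𝓝[<] s).NeBot :=
  nhdsLT_neBot_of_exists_lt ⟨0, hs⟩

/-- The left limit of a piecewise constant path is attained, at a time that can be chosen after
any finite set of earlier times. -/
theorem IsPiecewiseConst.exists_left {f : ℝ≥0 → E} (h : IsPiecewiseConst f) {s : ℝ≥0}
    (hs : 0 < s) {F' : Set ℝ≥0} (hF' : F'.Finite) :
    ∃ s₀ < s, (∀ φ ∈ F', s₀ < φ → ¬ φ < s) ∧ ∀ᶠ τ in 𝓝[<] s, f τ = f s₀ := by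
  obtain ⟨F, hF, h⟩ := h s
  have := nhdsLT_neBot_of_pos hs
  obtain ⟨s₀, h1, h2⟩ := ((eventually_forall_finite_not_mem_Ioo (hF.union hF') s).and
    self_mem_nhdsWithin).exists
  refine ⟨s₀, h2, fun φ hφ h3 h4 => (h1 φ (.inr hφ) h4).not_gt h3, ?_⟩
  filter_upwards [nhdsWithin_le_nhds (Ioi_mem_nhds h2), self_mem_nhdsWithin] with τ hτ hτ'
  exact h s₀ τ hτ.le (Set.mem_Iio.1 hτ').le fun φ hφ h3 h4 =>
    (h1 φ (.inl hφ) (h4.trans_lt hτ')).not_gt h3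

variable [TopologicalSpace E]

theorem IsPiecewiseConst.isCadlag {f : ℝ≥0 → E} (h : IsPiecewiseConst f) : IsCadlag f := by
  intro s
  refine ⟨tendsto_const_nhds.congr' ((h.eventually_right s).mono fun _ h => h.symm), ?_⟩
  rcases eq_zero_or_pos s with rfl | hs
  · refine ⟨f 0, ?_⟩
    have : 𝓝[<] (0 : ℝ≥0) = ⊥ := by
      rw [show Set.Iio (0 : ℝ≥0) = ∅ from by ext; simp, nhdsWithin_empty]
    rw [this]
    exact tendsto_bot
  · obtain ⟨s₀, -, -, h0⟩ := h.exists_left hs Set.finite_empty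
    exact ⟨f s₀, tendsto_const_nhds.congr' (h0.mono fun _ h => h.symm)⟩

theorem leftLim_eq_of_eventually [T2Space E] {f : ℝ≥0 → E} {s : ℝ≥0} (hs : 0 < s) {c : E}
    (h : ∀ᶠ τ in 𝓝[<] s, f τ = c) : Function.leftLim f s = c := by
  have := nhdsLT_neBot_of_pos hs
  exact leftLim_eq_of_tendsto (tendsto_const_nhds.congr' (h.mono fun _ h => h.symm))

theorem leftLim_nnreal_zero (f : ℝ≥0 → E) : Function.leftLim f 0 = f 0 := by
  refine leftLim_eq_of_eq_bot f ?_
  rw [show Set.Iio (0 : ℝ≥0) = ∅ from by ext; simp, nhdsWithin_empty]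

end Paths

theorem limUnder_eq_of_eventually {E : Type*} [TopologicalSpace E] [T2Space E] [Nonempty E]
    {f : ℕ → E} {c : E} (h : ∀ᶠ n in atTop, f n = c) : limUnder atTop f = c :=
  (tendsto_const_nhds.congr' (h.mono fun _ h => h.symm)).limUnder_eq

/-- Induction over time: a property propagates over intervals whose interior contains none of
finitely many given times. -/
theorem nnreal_induction {F : Set ℝ≥0} (hF : F.Finite) {T : ℝ≥0} (Q : ℝ≥0 → Prop) (h0 : Q 0)
    (h : ∀ s s', s < s' → s' ≤ T → (∀ φ ∈ F, s < φ → ¬ φ < s') → Q s → Q s') :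
    ∀ s ≤ T, Q s := by
  -- Induction on the number of exceptional times strictly before `s`: the last of them has fewer
  -- predecessors, and no exceptional time separates it from `s`.
  suffices H : ∀ n, ∀ s ≤ T, (F ∩ Set.Iio s).ncard ≤ n → Q s from fun s hs => H _ s hs le_rfl
  intro n
  induction n with
  | zero =>
    intro s hs hn
    have he : F ∩ Set.Iio s = ∅ := by
      rwa [Nat.le_zero, Set.ncard_eq_zero (hF.inter_of_left _)] at hn
    rcases eq_zero_or_pos s with rfl | hs0
    · exact h0
    · refine h 0 s hs0 hs (fun φ hφ _ hφs => ?_) h0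
      have : φ ∈ F ∩ Set.Iio s := ⟨hφ, hφs⟩
      rw [he] at this
      exact this
  | succ n ih =>
    intro s hs hn
    by_cases he : (F ∩ Set.Iio s).Nonempty
    · obtain ⟨m, hm, hmax⟩ := (hF.inter_of_left (Set.Iio s)).exists_maximalFor id _ he
      refine h m s hm.2 hs (fun φ hφ h1 h2 => ?_) (ih m (hm.2.le.trans hs) ?_)
      · exact h1.not_ge (hmax ⟨hφ, h2⟩ h1.le)
      · refine Nat.le_of_lt_succ ((Set.ncard_lt_ncard ⟨?_, fun hsub => ?_⟩
          (hF.inter_of_left _)).trans_le hn)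
        · exact fun x hx => ⟨hx.1, Set.mem_Iio.2 (lt_trans (Set.mem_Iio.1 hx.2) (Set.mem_Iio.1 hm.2))⟩
        · exact lt_irrefl m (hsub hm).2
    · refine ih s hs ?_
      rw [Set.not_nonempty_iff_eq_empty.1 he]
      simp

/-! ### Construction and uniqueness of the evolution -/

/-- The update of the zero-range process at a potential jump event. -/
def jump (α : ℤ → ℝ) (g : ℕ → ℝ) (E : Event) (η : Config) : Config :=
  if E.2.2.1 ≤ α E.2.1 * g (η E.2.1) then move η E.2.1 (E.2.1 + E.2.2.2) else η

/-- Two configurations agree on the sites of the block `(A, B]`. -/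
def AgreeOn (A B : ℤ) (η η' : Config) : Prop := ∀ y, A < y → y ≤ B → η y = η' y

variable {α : ℤ → ℝ} {g : ℕ → ℝ} {ev : ℕ → Event}

theorem jump_apply_of_ne {E : Event} {η : Config} {y : ℤ} (h1 : y ≠ E.2.1)
    (h2 : y ≠ E.2.1 + E.2.2.2) : jump α g E η y = η y := by
  unfold jump move
  split_ifs <;> simp [h1, h2]

theorem IsValid.bond_cases {E : Event} (h : IsValid E) :
    (E.2.2.2 = 1 ∧ bond E = E.2.1) ∨ (E.2.2.2 = -1 ∧ bond E = E.2.1 - 1) := by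
  unfold bond
  rcases h.2.2 with h | h <;> simp [h]

/-- Bond `b` joins the sites `b` and `b + 1`. If `A < b < B`, both lie in `(A, B]`; if `b < A` or `b
> B`, neither does. Hence the half-open block of sites. -/
theorem isLocal_jump (A B : ℤ) : IsLocal (jump α g) (AgreeOn A B) A B where
  inner E hE h1 h2 x y hxy w hw hw' := by
    have e1 : x E.2.1 = y E.2.1 := by
      rcases hE.bond_cases with h | h <;> exact hxy _ (by omega) (by omega)
    unfold jump move
    rw [e1]
    split_ifs <;> simp [hxy w hw hw']
  outer E hE h1 x y hxy w hw hw' := by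
    rw [jump_apply_of_ne, hxy w hw hw'] <;> rcases hE.bond_cases with h | h <;> omega

theorem AgreeOn.refl (A B : ℤ) (η : Config) : AgreeOn A B η η := fun _ _ _ => rfl

/-- The limit of the evolutions driven by the first `n` events. -/
def limitPath (α : ℤ → ℝ) (g : ℕ → ℝ) (ev : ℕ → Event) (η₀ : Config) (s : ℝ≥0) : Config :=
  fun y => limUnder atTop fun n => run (jump α g) ev (labels ev n) s η₀ y

theorem IsRegular.eventually_run_jump (h : IsRegular ev) {T : ℝ} {A B : ℤ}
    (hb : IsBlock ev T A B) {l : List ℕ} (hl : IsBlockList ev T A B l) (η₀ : Config)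
    {s : ℝ} (hs : s ≤ T) : ∀ᶠ n in atTop,
      AgreeOn A B (run (jump α g) ev (labels ev n) s η₀) (run (jump α g) ev l s η₀) := by
  obtain ⟨n₀, hn₀⟩ := h.run_stabilizes hb hl
  filter_upwards [eventually_ge_atTop n₀] with n hn
  exact hn₀ n hn s hs _ _ _ (isLocal_jump A B) _ (AgreeOn.refl A B _)

theorem IsRegular.limitPath_eq (h : IsRegular ev) {T : ℝ} {A B : ℤ}
    (hb : IsBlock ev T A B) {l : List ℕ} (hl : IsBlockList ev T A B l) (η₀ : Config)
    {s : ℝ≥0} (hs : s ≤ T) :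
    AgreeOn A B (limitPath α g ev η₀ s) (run (jump α g) ev l s η₀) := fun y h1 h2 =>
  limUnder_eq_of_eventually ((h.eventually_run_jump hb hl η₀ hs).mono fun _ h => h y h1 h2)

theorem IsRegular.eventually_run_eq_limitPath (h : IsRegular ev) (η₀ : Config) (s : ℝ≥0) (y : ℤ) :
    ∀ᶠ n in atTop, run (jump α g) ev (labels ev n) s η₀ y = limitPath α g ev η₀ s y := by
  obtain ⟨A, B, hA, hB, hb⟩ := h.exists_block s (y - 1) y
  obtain ⟨l, hl, -⟩ := h.exists_isBlockList s A B
  filter_upwards [h.eventually_run_jump (α := α) (g := g) hb hl η₀ le_rfl] with n hn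
  rw [hn y (by omega) hB, h.limitPath_eq hb hl η₀ le_rfl y (by omega) hB]

/-- The event times of a list of labels. -/
def times (ev : ℕ → Event) (l : List ℕ) : Set ℝ≥0 := (fun i => (ev i).1.toNNReal) '' {i | i ∈ l}

theorem times_finite (ev : ℕ → Event) (l : List ℕ) : (times ev l).Finite :=
  (List.finite_toSet l).image _

theorem run_eq_of_times {σ : Type*} {U : Event → σ → σ} {l : List ℕ}
    (hl : l.Pairwise (fun i j => (ev i).1 ≤ (ev j).1)) (hv : ∀ i, IsValid (ev i))
    {s s' : ℝ≥0} (hs : s ≤ s') (h : ∀ φ ∈ times ev l, s < φ → ¬ φ ≤ s') (x : σ) :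
    run U ev l s' x = run U ev l s x := by
  refine run_eq_of_forall_not hl (by exact_mod_cast hs) (fun i hi h1 h2 => ?_) x
  refine h _ ⟨i, hi, rfl⟩ ?_ ?_
  · rw [← NNReal.coe_lt_coe, Real.coe_toNNReal _ (hv i).1.le]; exact h1
  · rw [← NNReal.coe_le_coe, Real.coe_toNNReal _ (hv i).1.le]; exact h2

theorem run_zero {σ : Type*} {U : Event → σ → σ} {l : List ℕ} (hv : ∀ i, IsValid (ev i)) (x : σ) :
    run U ev l 0 x = x := by
  have : l.filter (fun i => (ev i).1 ≤ 0) = [] := by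
    simp only [List.filter_eq_nil_iff, decide_eq_true_eq]
    exact fun i _ => not_le.2 (hv i).1
  simp only [run, this, List.foldl_nil]

/-- At the time of a label in the list, `run` performs one update, starting from its value at
any time after the previous events of the list. -/
theorem IsRegular.run_update (h : IsRegular ev) {T : ℝ} {A B : ℤ} {l : List ℕ}
    (hl : IsBlockList ev T A B l) {σ : Type*} (U : Event → σ → σ) {i : ℕ} (hi : i ∈ l)
    {s : ℝ≥0} (hs : s < (ev i).1) (hF : ∀ φ ∈ times ev l, s < φ → ¬ φ < (ev i).1) (x : σ) :
    run U ev l (ev i).1 x = U (ev i) (run U ev l s x) := by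
  refine run_eq_update hl.pairwise hl.nodup hi hs (fun j hj h1 h2 => ?_) x
  refine h.inj _ _ (le_antisymm h2 (not_lt.1 fun h3 => hF _ ⟨j, hj, rfl⟩ ?_ ?_))
  · rw [← NNReal.coe_lt_coe, Real.coe_toNNReal _ (h.valid j).1.le]; exact h1
  · rw [Real.coe_toNNReal _ (h.valid j).1.le]; exact h3

theorem IsRegular.isPiecewiseConst_limitPath (h : IsRegular ev) (η₀ : Config) (y : ℤ) :
    IsPiecewiseConst (fun s => limitPath α g ev η₀ s y) := by
  intro T
  obtain ⟨A, B, hA, hB, hb⟩ := h.exists_block T (y - 1) y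
  obtain ⟨l, hl, -⟩ := h.exists_isBlockList T A B
  refine ⟨times ev l, times_finite ev l, fun s s' hs hs' hF => ?_⟩
  beta_reduce
  rw [h.limitPath_eq hb hl η₀ (by exact_mod_cast hs') y (by omega) hB,
    h.limitPath_eq hb hl η₀ (by exact_mod_cast hs.trans hs') y (by omega) hB,
    run_eq_of_times hl.pairwise h.valid hs hF]

theorem leftLim_config_apply {η : ℝ≥0 → Config} {s : ℝ≥0}
    (h : ∃ l, Tendsto η (𝓝[<] s) (𝓝 l)) (y : ℤ) :
    Function.leftLim η s y = Function.leftLim (fun τ => η τ y) s := by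
  rcases eq_zero_or_pos s with rfl | hs
  · rw [leftLim_nnreal_zero, leftLim_nnreal_zero]
  · have := nhdsLT_neBot_of_pos hs
    obtain ⟨l, hl⟩ := h
    rw [leftLim_eq_of_tendsto hl, leftLim_eq_of_tendsto (tendsto_pi_nhds.1 hl y)]

theorem isCadlag_config {η : ℝ≥0 → Config} (h : ∀ y, IsCadlag (fun s => η s y)) : IsCadlag η := by
  intro s
  choose l hl using fun y => (h y s).2
  exact ⟨tendsto_pi_nhds.2 fun y => (h y s).1, l, tendsto_pi_nhds.2 hl⟩

theorem IsRegular.isHarrisPath_limitPath (h : IsRegular ev) (η₀ : Config) :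
    IsHarrisPath α g (Set.range ev) η₀ (limitPath α g ev η₀) := by
  have hcad : IsCadlag (limitPath α g ev η₀) :=
    isCadlag_config fun y => (h.isPiecewiseConst_limitPath η₀ y).isCadlag
  refine ⟨?_, hcad, ?_, ?_⟩
  · ext y
    refine limUnder_eq_of_eventually (Eventually.of_forall fun n => ?_)
    rw [NNReal.coe_zero, run_zero h.valid]
  · rintro s x v z ⟨i, hi⟩
    have hs : 0 < s := by
      have := (h.valid i).1
      rw [hi] at this
      exact_mod_cast this
    have hti : (ev i).1 = s := by rw [hi]
    have key : ∀ w, limitPath α g ev η₀ s w =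
        jump α g (ev i) (Function.leftLim (limitPath α g ev η₀) s) w := by
      intro w
      -- The margin of `2` puts the bond of the event, which is `x` or `x - 1`, strictly inside a
      -- block that also contains `w`.
      obtain ⟨A, B, hA, hB, hb⟩ := h.exists_block s (min w x - 2) (max w x + 2)
      obtain ⟨l, hl, -⟩ := h.exists_isBlockList s A B
      have hbi : A < bond (ev i) ∧ bond (ev i) < B := by
        have hxi : (ev i).2.1 = x := by rw [hi]
        rcases (h.valid i).bond_cases with hc | hc <;> omega
      have hil : i ∈ l := (hl.mem_iff i).2 ⟨hbi, hti.le⟩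
      -- No event of the block occurs between `s₀` and `s`, so the state at `s₀` is the left limit
      -- at `s` on the whole block.
      obtain ⟨s₀, hs₀, hF, -⟩ := (h.isPiecewiseConst_limitPath (α := α) (g := g) η₀ w).exists_left
        hs (times_finite ev l)
      have hleft : AgreeOn A B (run (jump α g) ev l s₀ η₀)
          (Function.leftLim (limitPath α g ev η₀) s) := by
        intro y hy hy'
        rw [leftLim_config_apply (hcad s).2]
        refine (leftLim_eq_of_eventually hs ?_).symm
        filter_upwards [nhdsWithin_le_nhds (Ioi_mem_nhds hs₀), self_mem_nhdsWithin] with τ hτ hτ'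
        rw [h.limitPath_eq hb hl η₀ (by exact_mod_cast (Set.mem_Iio.1 hτ').le) y hy hy']
        rw [run_eq_of_times hl.pairwise h.valid (Set.mem_Ioi.1 hτ).le]
        exact fun φ hφ h1 h2 => hF φ hφ h1 (h2.trans_lt hτ')
      rw [h.limitPath_eq hb hl η₀ le_rfl w (by omega) (by omega), ← hti,
        h.run_update hl _ hil (s := s₀) (by rw [hti]; exact_mod_cast hs₀)
          (fun φ hφ h1 h2 => hF φ hφ h1 (by rw [hti] at h2; exact_mod_cast h2))]
      exact (isLocal_jump A B).inner _ (h.valid i) hbi.1 hbi.2 _ _ hleft w (by omega) (by omega)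
    ext w
    rw [key w, hi]
    rfl
  · intro x s s' hs hno τ hτ hτ'
    obtain ⟨A, B, hA, hB, hb⟩ := h.exists_block s' (x - 1) x
    obtain ⟨l, hl, -⟩ := h.exists_isBlockList s' A B
    rw [h.limitPath_eq hb hl η₀ (by exact_mod_cast hτ') x (by omega) hB,
      h.limitPath_eq hb hl η₀ (by exact_mod_cast hs) x (by omega) hB,
      run_split hl.pairwise (s := s) (by exact_mod_cast hτ.le)]
    refine run_induction (fun ζ : Config => ζ x = run (jump α g) ev l s η₀ x)
      (fun i hi his ζ hζ => ?_) rfl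
    rw [← hζ]
    simp only [List.mem_filter, decide_eq_true_eq] at hi
    have := hno (ev i).1.toNNReal (ev i).2.1 (ev i).2.2.1 (ev i).2.2.2 ⟨i, by
      rw [Real.coe_toNNReal _ (h.valid i).1.le]⟩
      (by rw [← NNReal.coe_lt_coe, Real.coe_toNNReal _ (h.valid i).1.le]; exact hi.2)
      (by rw [← NNReal.coe_le_coe, Real.coe_toNNReal _ (h.valid i).1.le]
          exact his.trans (by exact_mod_cast hτ'))
    exact jump_apply_of_ne this.1 this.2

theorem IsHarrisPath.leftLim_apply {S : Set Event} {η₀ : Config} {η : ℝ≥0 → Config}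
    (hη : IsHarrisPath α g S η₀ η) {s s' : ℝ≥0} (hs : s < s') {y : ℤ}
    (h : ∀ (τ : ℝ≥0) (x : ℤ) (v : ℝ) (z : ℤ), ((τ : ℝ), x, v, z) ∈ S → s < τ → τ < s' →
      y ≠ x ∧ y ≠ x + z) : Function.leftLim η s' y = η s y := by
  rw [leftLim_config_apply (hη.cadlag s').2]
  refine leftLim_eq_of_eventually (bot_lt_of_lt hs) ?_
  filter_upwards [nhdsWithin_le_nhds (Ioi_mem_nhds hs), self_mem_nhdsWithin] with τ hτ hτ'
  exact hη.no_event y s τ (le_of_lt hτ) (fun τ' x v z hS h1 h2 => h τ' x v z hS h1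
    (h2.trans_lt hτ')) τ hτ le_rfl

/-- On a block nothing enters or leaves up to time `T`. Two solutions stay constant there between
the finitely many block events and apply the same local update to equal left limits at such an
event, so agreement propagates in time. -/
theorem IsRegular.isHarrisPath_unique (h : IsRegular ev) {η₀ : Config} {η η' : ℝ≥0 → Config}
    (hη : IsHarrisPath α g (Set.range ev) η₀ η) (hη' : IsHarrisPath α g (Set.range ev) η₀ η') :
    η = η' := by
  ext T w
  obtain ⟨A, B, hA, hB, hb⟩ := h.exists_block T (w - 1) w
  obtain ⟨l, hl, -⟩ := h.exists_isBlockList T A B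
  suffices H : ∀ s ≤ T, AgreeOn A B (η s) (η' s) from H T le_rfl w (by omega) hB
  refine nnreal_induction (times_finite ev l) _ (by rw [hη.init, hη'.init]; exact .refl A B _) ?_
  intro s s' hs hs' hF hag
  have hin : ∀ i, (ev i).1 ≤ s' → ∀ y, A < y → y ≤ B →
      (y = (ev i).2.1 ∨ y = (ev i).2.1 + (ev i).2.2.2) → i ∈ l := by
    intro i hi y hy hy' hyi
    have hT : (ev i).1 ≤ T := hi.trans (by exact_mod_cast hs')
    have := hb i hT
    refine (hl.mem_iff i).2 ⟨?_, hT⟩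
    rcases (h.valid i).bond_cases with hc | hc <;> omega
  have hno : ∀ y, A < y → y ≤ B → ∀ (τ : ℝ≥0) (x : ℤ) (v : ℝ) (z : ℤ),
      ((τ : ℝ), x, v, z) ∈ Set.range ev → s < τ → τ < s' → y ≠ x ∧ y ≠ x + z := by
    rintro y hy hy' τ x v z ⟨i, hi⟩ h1 h2
    by_contra hcon
    have hil : i ∈ l := hin i (by rw [hi]; exact_mod_cast h2.le) y hy hy' (by
      rw [hi]; by_contra hcon'; exact hcon (by simpa [not_or] using hcon'))
    exact hF τ ⟨i, hil, by simp [hi]⟩ h1 h2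
  have hL : AgreeOn A B (Function.leftLim η s') (Function.leftLim η' s') := fun y hy hy' => by
    rw [hη.leftLim_apply hs (hno y hy hy'), hη'.leftLim_apply hs (hno y hy hy'), hag y hy hy']
  by_cases hex : ∃ i ∈ l, (ev i).1 = s'
  · obtain ⟨i, hi, his⟩ := hex
    have hm : ((s' : ℝ), (ev i).2.1, (ev i).2.2.1, (ev i).2.2.2) ∈ Set.range ev := ⟨i, by rw [← his]⟩
    have e1 : η s' = jump α g (ev i) (Function.leftLim η s') := hη.at_event _ _ _ _ hm
    have e2 : η' s' = jump α g (ev i) (Function.leftLim η' s') := hη'.at_event _ _ _ _ hm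
    rw [e1, e2]
    have hbi := ((hl.mem_iff i).1 hi).1
    exact (isLocal_jump A B).inner _ (h.valid i) hbi.1 hbi.2 _ _ hL
  · intro y hy hy'
    have hno' : ∀ (τ : ℝ≥0) (x : ℤ) (v : ℝ) (z : ℤ),
        ((τ : ℝ), x, v, z) ∈ Set.range ev → s < τ → τ ≤ s' → y ≠ x ∧ y ≠ x + z := by
      rintro τ x v z hS h1 h2
      rcases h2.lt_or_eq with h2 | rfl
      · exact hno y hy hy' τ x v z hS h1 h2
      · obtain ⟨i, hi⟩ := hS
        by_contra hcon
        refine hex ⟨i, hin i (by rw [hi]) y hy hy' (by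
          rw [hi]; by_contra hcon'; exact hcon (by simpa [not_or] using hcon')), by rw [hi]⟩
    rw [hη.no_event y s s' hs.le hno' s' hs le_rfl, hη'.no_event y s s' hs.le hno' s' hs le_rfl,
      hag y hy hy']

theorem IsRegular.existsUnique_isHarrisPath (h : IsRegular ev) (η₀ : Config) :
    ∃! η, IsHarrisPath α g (Set.range ev) η₀ η :=
  ⟨_, h.isHarrisPath_limitPath η₀, fun _ hη => h.isHarrisPath_unique hη (h.isHarrisPath_limitPath η₀)⟩

theorem IsRegular.flow_eq (h : IsRegular ev) (η₀ : Config) :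
    flow α g (Set.range ev) η₀ = limitPath α g ev η₀ := by
  have hex : ∃ η, IsHarrisPath α g (Set.range ev) η₀ η := ⟨_, h.isHarrisPath_limitPath η₀⟩
  rw [flow, dif_pos hex]
  exact h.isHarrisPath_unique hex.choose_spec (h.isHarrisPath_limitPath η₀)

/-! ### Interfaces and dominating walks -/

section Interface

variable {α : ℤ → ℝ} {g : ℕ → ℝ} {ev : ℕ → Event}

/-- The joint update of two configurations and of an interface between them: the interface moves
only at events on its own bond, and only if it would cease to be an interface otherwise. -/
def interfaceStep (α : ℤ → ℝ) (g : ℕ → ℝ) (E : Event) (x : Config × Config × ℤ) :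
    Config × Config × ℤ :=
  (jump α g E x.1, jump α g E x.2.1,
    if bond E = x.2.2 ∧ jump α g E x.1 (x.2.2 + 1) < jump α g E x.2.1 (x.2.2 + 1) then x.2.2 + 1
    else if bond E = x.2.2 ∧ jump α g E x.2.1 x.2.2 < jump α g E x.1 x.2.2 then x.2.2 - 1
    else x.2.2)

/-- A walk that makes a step `δ` at every event on its bond. -/
def walkStep (δ : ℤ) (E : Event) (x : ℤ) : ℤ := if bond E = x then x + δ else x

/-- Attractiveness. Both processes compare the same mark with a nondecreasing function of the
occupation number, so a lone jump comes from the larger one. A jumping process has a particle at the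
departure site because `g 0 = 0` and the mark is positive; this keeps the truncated subtraction in
`move` exact. -/
theorem jump_cases (hg : IsJumpRate g) (hα : ∀ x, 0 ≤ α x) {E : Event} (hE : IsValid E)
    (η ξ : Config) :
    (jump α g E η = move η E.2.1 (E.2.1 + E.2.2.2) ∧ jump α g E ξ = move ξ E.2.1 (E.2.1 + E.2.2.2) ∧
      0 < η E.2.1 ∧ 0 < ξ E.2.1) ∨
    (jump α g E η = η ∧ jump α g E ξ = ξ) ∨
    (jump α g E η = move η E.2.1 (E.2.1 + E.2.2.2) ∧ jump α g E ξ = ξ ∧ ξ E.2.1 < η E.2.1) ∨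
    (jump α g E η = η ∧ jump α g E ξ = move ξ E.2.1 (E.2.1 + E.2.2.2) ∧ η E.2.1 < ξ E.2.1) := by
  have hpos : ∀ ζ : Config, E.2.2.1 ≤ α E.2.1 * g (ζ E.2.1) → 0 < ζ E.2.1 := by
    intro ζ h
    rw [Nat.pos_iff_ne_zero]
    intro h0
    rw [h0, hg.zero, mul_zero] at h
    exact h.not_gt hE.2.1.1
  have hlt : ∀ ζ ζ' : Config, E.2.2.1 ≤ α E.2.1 * g (ζ E.2.1) →
      ¬ E.2.2.1 ≤ α E.2.1 * g (ζ' E.2.1) → ζ' E.2.1 < ζ E.2.1 := by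
    intro ζ ζ' h h'
    by_contra hle
    exact h' (h.trans (mul_le_mul_of_nonneg_left (hg.monotone (not_lt.1 hle)) (hα _)))
  unfold jump
  by_cases h1 : E.2.2.1 ≤ α E.2.1 * g (η E.2.1) <;> by_cases h2 : E.2.2.1 ≤ α E.2.1 * g (ξ E.2.1)
  · exact .inl ⟨if_pos h1, if_pos h2, hpos η h1, hpos ξ h2⟩
  · exact .inr (.inr (.inl ⟨if_pos h1, if_neg h2, hlt η ξ h1 h2⟩))
  · exact .inr (.inr (.inr ⟨if_neg h1, if_pos h2, hlt ξ η h2 h1⟩))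
  · exact .inr (.inl ⟨if_neg h1, if_neg h2⟩)

theorem jump_mono (hg : IsJumpRate g) (hα : ∀ x, 0 ≤ α x) {E : Event} (hE : IsValid E)
    {η ξ : Config} (h : η ≤ ξ) : jump α g E η ≤ jump α g E ξ := by
  intro y
  have hx : η E.2.1 ≤ ξ E.2.1 := h E.2.1
  have hy : η y ≤ ξ y := h y
  show (jump α g E η y : ℕ) ≤ jump α g E ξ y
  rcases jump_cases hg hα hE η ξ with ⟨h1, h2, h3⟩ | ⟨h1, h2⟩ | ⟨h1, h2, h3⟩ | ⟨h1, h2, h3⟩ <;>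
    rw [h1, h2]
  · unfold move
    omega
  · exact hy
  · omega
  · unfold move
    by_cases hyx : y = E.2.1
    · rw [hyx]; split_ifs <;> omega
    · split_ifs <;> omega

/-- Away from the bond of the interface, both sites of the jump lie on one side, and attractiveness
preserves the order there. On that bond a lone jump keeps the order at the departure site, up to
equality, and can break it only at the arrival site; the interface then crosses that site. -/
theorem isInterface_interfaceStep (hg : IsJumpRate g) (hα : ∀ x, 0 ≤ α x) {E : Event}
    (hE : IsValid E) {x : Config × Config × ℤ} (h : IsInterface x.1 x.2.1 x.2.2) :
    IsInterface (interfaceStep α g E x).1 (interfaceStep α g E x).2.1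
      (interfaceStep α g E x).2.2 := by
  obtain ⟨η, ξ, X⟩ := x
  obtain ⟨t, x, v, z⟩ := E
  simp only [interfaceStep] at *
  have hb := hE.bond_cases
  simp only at hb
  have hc := jump_cases hg hα hE η ξ
  simp only at hc
  have key : ∀ y, (y ≤ X → η y ≤ ξ y) ∧ (X < y → ξ y ≤ η y) := fun y => ⟨h.1 y, h.2 y⟩
  generalize bond (t, x, v, z) = b at *
  generalize jump α g (t, x, v, z) η = η' at *
  generalize jump α g (t, x, v, z) ξ = ξ' at *
  have kx := key x
  have kX := key X
  have kX1 := key (X + 1)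
  rcases hc with ⟨rfl, rfl, h3⟩ | ⟨rfl, rfl⟩ | ⟨rfl, rfl, h3⟩ | ⟨rfl, rfl, h3⟩ <;>
  · refine ⟨fun y hy => ?_, fun y hy => ?_⟩ <;>
    · have ky := key y
      unfold move at *
      grind

/-- If `X < X'`, an event sits on the bond of at most one of them, so a unit step cannot reverse the
order. If `X = X'`, raising `ξ` favours the test for moving right and disfavours the one for moving
left. -/
theorem interfaceStep_le (hg : IsJumpRate g) (hα : ∀ x, 0 ≤ α x) {E : Event}
    (hE : IsValid E) {η ξ ξ' : Config} {X X' : ℤ} (h : IsInterface η ξ X)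
    (h' : IsInterface η ξ' X') (hξ : ξ ≤ ξ') (hX : X ≤ X') :
    (interfaceStep α g E (η, ξ, X)).2.2 ≤ (interfaceStep α g E (η, ξ', X')).2.2 := by
  have hj := jump_mono hg hα hE hξ
  have hi := isInterface_interfaceStep hg hα hE (x := (η, ξ, X)) h
  have hi' := isInterface_interfaceStep hg hα hE (x := (η, ξ', X')) h'
  simp only [interfaceStep] at *
  have j1 := hj X
  have j2 := hj (X + 1)
  have j3 := hj X'
  grind

/-- When the positions coincide, both see the same event and the walk makes the largest possible
step; when they differ, only one of them can move, and by one unit. -/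
theorem interfaceStep_le_walkStep {E : Event} {x : Config × Config × ℤ} {y : ℤ} (h : x.2.2 ≤ y) :
    (interfaceStep α g E x).2.2 ≤ walkStep 1 E y := by
  unfold interfaceStep walkStep
  simp only
  split_ifs <;> omega

theorem walkStep_le_interfaceStep {E : Event} {x : Config × Config × ℤ} {y : ℤ} (h : y ≤ x.2.2) :
    walkStep (-1) E y ≤ (interfaceStep α g E x).2.2 := by
  unfold interfaceStep walkStep
  simp only
  split_ifs <;> omega

theorem abs_interfaceStep_sub_le (E : Event) (x : Config × Config × ℤ) :
    |(interfaceStep α g E x).2.2 - x.2.2| ≤ 1 := by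
  unfold interfaceStep
  simp only
  split_ifs <;> simp

/-- Agreement on a block that contains the interface. -/
def InterfaceAgree (A B : ℤ) (x y : Config × Config × ℤ) : Prop :=
  AgreeOn A B x.1 y.1 ∧ AgreeOn A B x.2.1 y.2.1 ∧ x.2.2 = y.2.2 ∧ A ≤ x.2.2 ∧ x.2.2 ≤ B

/-- Only an event with `A < bond E < B` can move the interface, and it then starts strictly inside,
so it never leaves `[A, B]`. The sites `X` and `X + 1` that decide the move belong to `(A, B]`. -/
theorem isLocal_interfaceStep (A B : ℤ) :
    IsLocal (interfaceStep α g) (InterfaceAgree A B) A B where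
  inner E hE h1 h2 := by
    rintro ⟨η, ξ, X⟩ ⟨η', ξ', X'⟩ ⟨ha, hb, rfl, hA, hB⟩
    have a1 := (isLocal_jump (α := α) (g := g) A B).inner E hE h1 h2 _ _ ha
    have a2 := (isLocal_jump (α := α) (g := g) A B).inner E hE h1 h2 _ _ hb
    simp only at hA hB
    refine ⟨a1, a2, ?_, ?_⟩
    · unfold interfaceStep
      simp only
      by_cases hbX : bond E = X
      · rw [a1 X (by omega) (by omega), a2 X (by omega) (by omega),
          a1 (X + 1) (by omega) (by omega), a2 (X + 1) (by omega) (by omega)]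
      · simp [hbX]
    · unfold interfaceStep
      simp only
      split_ifs <;> omega
  outer E hE h1 := by
    rintro ⟨η, ξ, X⟩ ⟨η', ξ', X'⟩ ⟨ha, hb, rfl, hA, hB⟩
    have a1 := (isLocal_jump (α := α) (g := g) A B).outer E hE h1 _ _ ha
    have a2 := (isLocal_jump (α := α) (g := g) A B).outer E hE h1 _ _ hb
    simp only at hA hB
    have hbX : bond E ≠ X := by omega
    refine ⟨a1, a2, ?_, ?_⟩ <;> simp [interfaceStep, hbX, hA, hB]

theorem isLocal_walkStep {δ : ℤ} (hδ : |δ| ≤ 1) (A B : ℤ) :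
    IsLocal (walkStep δ) (fun x y => x = y ∧ A ≤ x ∧ x ≤ B) A B where
  inner E hE h1 h2 := by
    rintro x _ ⟨rfl, h3, h4⟩
    rw [abs_le] at hδ
    refine ⟨rfl, ?_⟩
    unfold walkStep
    split_ifs <;> omega
  outer E hE h1 := by
    rintro x _ ⟨rfl, h3, h4⟩
    have : bond E ≠ x := by omega
    simp [walkStep, this, h3, h4]

/-! ### Interfaces and walks in infinite volume -/

/-- The infinite-volume interface started at `a`. -/
def interfacePath (α : ℤ → ℝ) (g : ℕ → ℝ) (ev : ℕ → Event) (η₀ ξ₀ : Config) (a : ℤ) (s : ℝ≥0) : ℤ :=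
  limUnder atTop fun n => (run (interfaceStep α g) ev (labels ev n) s (η₀, ξ₀, a)).2.2

/-- The infinite-volume walk started at `a`. -/
def walkPath (δ : ℤ) (ev : ℕ → Event) (a : ℤ) (s : ℝ≥0) : ℤ :=
  limUnder atTop fun n => run (walkStep δ) ev (labels ev n) s a

theorem IsRegular.interfacePath_eq (h : IsRegular ev) {T : ℝ} {A B : ℤ}
    (hb : IsBlock ev T A B) {l : List ℕ} (hl : IsBlockList ev T A B l) (η₀ ξ₀ : Config)
    {a : ℤ} (hA : A ≤ a) (hB : a ≤ B) {s : ℝ≥0} (hs : s ≤ T) :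
    interfacePath α g ev η₀ ξ₀ a s = (run (interfaceStep α g) ev l s (η₀, ξ₀, a)).2.2 := by
  obtain ⟨n₀, hn₀⟩ := h.run_stabilizes hb hl
  refine limUnder_eq_of_eventually ?_
  filter_upwards [eventually_ge_atTop n₀] with n hn
  exact (hn₀ n hn s hs _ _ _ (isLocal_interfaceStep A B) _
    ⟨AgreeOn.refl A B _, AgreeOn.refl A B _, rfl, hA, hB⟩).2.2.1

theorem IsRegular.eventually_run_eq_interfacePath (h : IsRegular ev) (η₀ ξ₀ : Config) (a : ℤ)
    (s : ℝ≥0) : ∀ᶠ n in atTop, (run (interfaceStep α g) ev (labels ev n) s (η₀, ξ₀, a)).2.2 =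
      interfacePath α g ev η₀ ξ₀ a s := by
  obtain ⟨A, B, hA, hB, hb⟩ := h.exists_block s a a
  obtain ⟨l, hl, -⟩ := h.exists_isBlockList s A B
  obtain ⟨n₀, hn₀⟩ := h.run_stabilizes hb hl
  filter_upwards [eventually_ge_atTop n₀] with n hn
  rw [h.interfacePath_eq hb hl η₀ ξ₀ hA hB le_rfl]
  exact (hn₀ n hn s le_rfl _ _ _ (isLocal_interfaceStep A B) _
    ⟨AgreeOn.refl A B _, AgreeOn.refl A B _, rfl, hA, hB⟩).2.2.1

theorem IsRegular.walkPath_eq (h : IsRegular ev) {δ : ℤ} (hδ : |δ| ≤ 1) {T : ℝ} {A B : ℤ}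
    (hb : IsBlock ev T A B) {l : List ℕ} (hl : IsBlockList ev T A B l)
    {a : ℤ} (hA : A ≤ a) (hB : a ≤ B) {s : ℝ≥0} (hs : s ≤ T) :
    walkPath δ ev a s = run (walkStep δ) ev l s a := by
  obtain ⟨n₀, hn₀⟩ := h.run_stabilizes hb hl
  refine limUnder_eq_of_eventually ?_
  filter_upwards [eventually_ge_atTop n₀] with n hn
  exact (hn₀ n hn s hs _ _ _ (isLocal_walkStep hδ A B) _ ⟨rfl, hA, hB⟩).1

theorem IsRegular.eventually_run_eq_walkPath (h : IsRegular ev) {δ : ℤ} (hδ : |δ| ≤ 1) (a : ℤ)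
    (s : ℝ≥0) : ∀ᶠ n in atTop, run (walkStep δ) ev (labels ev n) s a = walkPath δ ev a s := by
  obtain ⟨A, B, hA, hB, hb⟩ := h.exists_block s a a
  obtain ⟨l, hl, -⟩ := h.exists_isBlockList s A B
  obtain ⟨n₀, hn₀⟩ := h.run_stabilizes hb hl
  filter_upwards [eventually_ge_atTop n₀] with n hn
  rw [h.walkPath_eq hδ hb hl hA hB le_rfl]
  exact (hn₀ n hn s le_rfl _ _ _ (isLocal_walkStep hδ A B) _ ⟨rfl, hA, hB⟩).1

/-- Paths that are functions of `run` along block lists. -/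
def IsRunPath {σ E : Type*} (ev : ℕ → Event) (U : Event → σ → σ) (x : σ) (pos : σ → E)
    (f : ℝ≥0 → E) : Prop :=
  ∀ T : ℝ≥0, ∃ A B l, IsBlockList ev T A B l ∧ ∀ s ≤ T, f s = pos (run U ev l s x)

theorem IsRegular.isRunPath_interfacePath (h : IsRegular ev) (η₀ ξ₀ : Config) (a : ℤ) :
    IsRunPath ev (interfaceStep α g) (η₀, ξ₀, a) (fun x => x.2.2)
      (interfacePath α g ev η₀ ξ₀ a) := by
  intro T
  obtain ⟨A, B, hA, hB, hb⟩ := h.exists_block T a a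
  obtain ⟨l, hl, -⟩ := h.exists_isBlockList T A B
  exact ⟨A, B, l, hl, fun s hs =>
    h.interfacePath_eq hb hl η₀ ξ₀ hA hB (by exact_mod_cast hs)⟩

theorem IsRegular.isRunPath_walkPath (h : IsRegular ev) {δ : ℤ} (hδ : |δ| ≤ 1) (a : ℤ) :
    IsRunPath ev (walkStep δ) a id (walkPath δ ev a) := by
  intro T
  obtain ⟨A, B, hA, hB, hb⟩ := h.exists_block T a a
  obtain ⟨l, hl, -⟩ := h.exists_isBlockList T A B
  exact ⟨A, B, l, hl, fun s hs => h.walkPath_eq hδ hb hl hA hB (by exact_mod_cast hs)⟩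

theorem IsRunPath.isPiecewiseConst {σ E : Type*} {U : Event → σ → σ} {x : σ} {pos : σ → E}
    {f : ℝ≥0 → E} (hf : IsRunPath ev U x pos f) (h : IsRegular ev) : IsPiecewiseConst f := by
  intro T
  obtain ⟨A, B, l, hl, hfl⟩ := hf T
  refine ⟨times ev l, times_finite ev l, fun s s' hs hs' hF => ?_⟩
  rw [hfl s' hs', hfl s (hs.trans hs'), run_eq_of_times hl.pairwise h.valid hs hF]

theorem IsRunPath.zero {σ E : Type*} {U : Event → σ → σ} {x : σ} {pos : σ → E}
    {f : ℝ≥0 → E} (hf : IsRunPath ev U x pos f) (h : IsRegular ev) : f 0 = pos x := by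
  obtain ⟨A, B, l, hl, hfl⟩ := hf 0
  rw [hfl 0 le_rfl, NNReal.coe_zero, run_zero h.valid]

theorem IsRunPath.isNearestNeighbourPath {σ : Type*} {U : Event → σ → σ} {x : σ} {pos : σ → ℤ}
    {f : ℝ≥0 → ℤ} (hf : IsRunPath ev U x pos f) (h : IsRegular ev)
    (hU : ∀ E x, |pos (U E x) - pos x| ≤ 1) : IsNearestNeighbourPath f where
  cadlag := (hf.isPiecewiseConst h).isCadlag
  finite_jumps T := by
    obtain ⟨F, hF, hfF⟩ := hf.isPiecewiseConst h T
    refine hF.subset fun s hs => ?_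
    by_contra hsF
    rcases eq_zero_or_pos s with rfl | hs0
    · exact hs.2 (leftLim_nnreal_zero f).symm
    · obtain ⟨s₀, h0, h1, h2⟩ := (hf.isPiecewiseConst h).exists_left hs0 hF
      refine hs.2 ?_
      rw [leftLim_eq_of_eventually hs0 h2]
      refine hfF s₀ s h0.le hs.1 fun φ hφ h3 h4 => h1 φ hφ h3 (lt_of_le_of_ne h4 ?_)
      rintro rfl
      exact hsF hφ
  nearest s := by
    rcases eq_zero_or_pos s with rfl | hs0
    · simp [leftLim_nnreal_zero f]
    · obtain ⟨A, B, l, hl, hfl⟩ := hf s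
      obtain ⟨s₀, h0, h1, h2⟩ := (hf.isPiecewiseConst h).exists_left hs0 (times_finite ev l)
      rw [leftLim_eq_of_eventually hs0 h2, hfl s le_rfl, hfl s₀ h0.le]
      by_cases hex : ∃ i ∈ l, (ev i).1 = s
      · obtain ⟨i, hi, his⟩ := hex
        rw [← his, h.run_update hl U hi (s := s₀) (by rw [his]; exact_mod_cast h0)
          (fun φ hφ h3 h4 => h1 φ hφ h3 (by rw [his] at h4; exact_mod_cast h4))]
        exact hU _ _
      · rw [run_eq_of_times hl.pairwise h.valid h0.le]
        · simp
        · rintro φ hφ h3 h4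
          refine h1 φ hφ h3 (lt_of_le_of_ne h4 ?_)
          rintro rfl
          obtain ⟨i, hi, his⟩ := hφ
          exact hex ⟨i, hi, by rw [← his, Real.coe_toNNReal _ (h.valid i).1.le]⟩

theorem run_interfaceStep_fst {l : List ℕ} (s : ℝ) (η ξ : Config) (a : ℤ) :
    (run (interfaceStep α g) ev l s (η, ξ, a)).1 = run (jump α g) ev l s η :=
  run_induction₂ (fun (x : Config × Config × ℤ) y => x.1 = y)
    (by rintro i - - x _ rfl; rfl) rfl

theorem run_interfaceStep_snd {l : List ℕ} (s : ℝ) (η ξ : Config) (a : ℤ) :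
    (run (interfaceStep α g) ev l s (η, ξ, a)).2.1 = run (jump α g) ev l s ξ :=
  run_induction₂ (fun (x : Config × Config × ℤ) y => x.2.1 = y)
    (by rintro i - - x _ rfl; rfl) rfl

/-- The relation holds for every finite run. For a fixed site and time, both occupation numbers and
the interface are attained exactly by one large `n`. -/
theorem IsRegular.isInterface_interfacePath (h : IsRegular ev) (hg : IsJumpRate g)
    (hα : ∀ x, 0 ≤ α x) {η ξ : Config} {a : ℤ} (h0 : IsInterface η ξ a) (s : ℝ≥0) :
    IsInterface (limitPath α g ev η s) (limitPath α g ev ξ s)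
      (interfacePath α g ev η ξ a s) := by
  have hn : ∀ n, IsInterface (run (jump α g) ev (labels ev n) s η)
      (run (jump α g) ev (labels ev n) s ξ)
      (run (interfaceStep α g) ev (labels ev n) s (η, ξ, a)).2.2 := fun n => by
    rw [← run_interfaceStep_fst s η ξ a, ← run_interfaceStep_snd s η ξ a]
    exact run_induction (fun x : Config × Config × ℤ => IsInterface x.1 x.2.1 x.2.2)
      (fun i _ _ x hx => isInterface_interfaceStep hg hα (h.valid i) hx) h0
  constructor <;>
  · intro y hy
    obtain ⟨n, h1, h2, h3⟩ := ((h.eventually_run_eq_limitPath (α := α) (g := g) η s y).and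
      ((h.eventually_run_eq_limitPath (α := α) (g := g) ξ s y).and
        (h.eventually_run_eq_interfacePath (α := α) (g := g) η ξ a s))).exists
    rw [← h3] at hy
    rw [← h1, ← h2]
    first | exact (hn n).1 y hy | exact (hn n).2 y hy

theorem IsRegular.interfacePath_mono (h : IsRegular ev) (hg : IsJumpRate g)
    (hα : ∀ x, 0 ≤ α x) {η ξ ξ' : Config} {a : ℤ} (h0 : IsInterface η ξ a)
    (h0' : IsInterface η ξ' a) (hξ : ξ ≤ ξ') (s : ℝ≥0) :
    interfacePath α g ev η ξ a s ≤ interfacePath α g ev η ξ' a s := by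
  obtain ⟨n, h1, h2⟩ := ((h.eventually_run_eq_interfacePath (α := α) (g := g) η ξ a s).and
    (h.eventually_run_eq_interfacePath (α := α) (g := g) η ξ' a s)).exists
  rw [← h1, ← h2]
  refine (run_induction₂ (fun x y : Config × Config × ℤ => x.1 = y.1 ∧ x.2.1 ≤ y.2.1 ∧
    IsInterface x.1 x.2.1 x.2.2 ∧ IsInterface y.1 y.2.1 y.2.2 ∧ x.2.2 ≤ y.2.2)
    (x := (η, ξ, a)) (y := (η, ξ', a)) ?_ ⟨rfl, hξ, h0, h0', le_rfl⟩).2.2.2.2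
  rintro i - - ⟨η, ξ, X⟩ ⟨_, ξ', X'⟩ ⟨rfl, h3, h4, h5, h6⟩
  exact ⟨rfl, jump_mono hg hα (h.valid i) h3, isInterface_interfaceStep hg hα (h.valid i) h4,
    isInterface_interfaceStep hg hα (h.valid i) h5, interfaceStep_le hg hα (h.valid i) h4 h5 h3 h6⟩

theorem IsRegular.interfacePath_le_walkPath (h : IsRegular ev) (η ξ : Config) (a : ℤ) (s : ℝ≥0) :
    interfacePath α g ev η ξ a s ≤ walkPath 1 ev a s := by
  obtain ⟨n, h1, h2⟩ := ((h.eventually_run_eq_interfacePath (α := α) (g := g) η ξ a s).and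
    (h.eventually_run_eq_walkPath (δ := 1) (by simp) a s)).exists
  rw [← h1, ← h2]
  exact run_induction₂ (fun (x : Config × Config × ℤ) y => x.2.2 ≤ y)
    (fun i _ _ x y hxy => interfaceStep_le_walkStep hxy) le_rfl

theorem IsRegular.walkPath_le_interfacePath (h : IsRegular ev) (η ξ : Config) (a : ℤ) (s : ℝ≥0) :
    walkPath (-1) ev a s ≤ interfacePath α g ev η ξ a s := by
  obtain ⟨n, h1, h2⟩ := ((h.eventually_run_eq_interfacePath (α := α) (g := g) η ξ a s).and
    (h.eventually_run_eq_walkPath (δ := -1) (by simp) a s)).exists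
  rw [← h1, ← h2]
  exact run_induction₂ (fun y (x : Config × Config × ℤ) => y ≤ x.2.2)
    (fun i _ _ x y hxy => walkStep_le_interfaceStep hxy) le_rfl

end Interface

/-! ### Measurability -/

section Measurability

theorem measurable_config_apply {β : Type*} [MeasurableSpace β] {η : β → Config} {x : β → ℤ}
    (hη : Measurable η) (hx : Measurable x) : Measurable fun b => η b (x b) := by
  have : Measurable fun p : Config × ℤ => p.1 p.2 :=
    measurable_from_prod_countable_left fun z => measurable_pi_apply z
  exact this.comp (hη.prodMk hx)

variable {Ω : Type*} [MeasurableSpace Ω] {e : ℕ → Ω → Event}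

theorem measurableSet_orderedInsert_eq {r : Ω → ℕ → ℕ → Prop}
    [∀ ω, DecidableRel (r ω)] (hr : ∀ i j, MeasurableSet {ω | r ω i j}) (a : ℕ) (l l' : List ℕ) :
    MeasurableSet {ω | l.orderedInsert (r ω) a = l'} := by
  induction l generalizing l' with
  | nil => simp
  | cons b l ih =>
    have : {ω | (b :: l).orderedInsert (r ω) a = l'} =
        ({ω | r ω a b} ∩ {ω | a :: b :: l = l'}) ∪
          ({ω | r ω a b}ᶜ ∩ {ω | b :: l.orderedInsert (r ω) a = l'}) := by
      ext ω
      by_cases h : r ω a b <;> simp [h]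
    rw [this]
    refine ((hr a b).inter (.const _)).union ((hr a b).compl.inter ?_)
    cases l' with
    | nil => simp
    | cons c l' =>
      simp only [List.cons.injEq]
      exact (MeasurableSet.const _).inter (ih l')

theorem measurableSet_labels_eq (he : ∀ i, Measurable (e i)) (n : ℕ) (l : List ℕ) :
    MeasurableSet {ω | labels (fun i => e i ω) n = l} := by
  induction n generalizing l with
  | zero => simp [labels]
  | succ n ih =>
    have : {ω | labels (fun i => e i ω) (n + 1) = l} =
        ⋃ l' : List ℕ, {ω | labels (fun i => e i ω) n = l'} ∩
          {ω | l'.orderedInsert (fun i j => (e i ω).1 ≤ (e j ω).1) n = l} := by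
      ext ω
      simp [labels]
    rw [this]
    exact MeasurableSet.iUnion fun l' => (ih l').inter
      (measurableSet_orderedInsert_eq (fun i j => measurableSet_le (he i).fst (he j).fst) _ _ _)

variable {σ : Type*} [MeasurableSpace σ] {U : Event → σ → σ}

theorem measurable_run_list (he : ∀ i, Measurable (e i))
    (hU : Measurable fun p : Event × σ => U p.1 p.2) (l : List ℕ) (s : ℝ) {x : Ω → σ}
    (hx : Measurable x) : Measurable fun ω => run U (fun i => e i ω) l s (x ω) := by
  induction l generalizing x with
  | nil => exact hx
  | cons i l ih =>
    simp only [run_cons]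
    exact ih (Measurable.ite (measurableSet_le (he i).fst measurable_const)
      (hU.comp ((he i).prodMk hx)) hx)

/-- The sorted list depends on `ω` but takes countably many values, and on each level set the run is
a fixed finite composition. -/
theorem measurable_run_labels (he : ∀ i, Measurable (e i))
    (hU : Measurable fun p : Event × σ => U p.1 p.2) (n : ℕ) (s : ℝ) {x : Ω → σ}
    (hx : Measurable x) :
    Measurable fun ω => run U (fun i => e i ω) (labels (fun i => e i ω) n) s (x ω) := by
  intro S hS
  have : (fun ω => run U (fun i => e i ω) (labels (fun i => e i ω) n) s (x ω)) ⁻¹' S =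
      ⋃ l : List ℕ, {ω | labels (fun i => e i ω) n = l} ∩
        (fun ω => run U (fun i => e i ω) l s (x ω)) ⁻¹' S := by
    ext ω
    simp
  rw [this]
  exact MeasurableSet.iUnion fun l => (measurableSet_labels_eq he n l).inter
    (measurable_run_list he hU l s hx hS)

theorem measurable_bond : Measurable bond :=
  Measurable.ite (measurableSet_eq_fun measurable_snd.snd.snd measurable_const)
    measurable_snd.fst (measurable_snd.fst.sub measurable_const)

theorem measurable_jump (α : ℤ → ℝ) (g : ℕ → ℝ) :
    Measurable fun p : Event × Config => jump α g p.1 p.2 := by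
  have hx : Measurable fun p : Event × Config => p.1.2.1 := measurable_fst.snd.fst
  have hz : Measurable fun p : Event × Config => p.1.2.2.2 := measurable_fst.snd.snd.snd
  refine Measurable.ite (measurableSet_le measurable_fst.snd.snd.fst ?_) ?_ measurable_snd
  · exact ((Measurable.of_discrete (f := α)).comp hx).mul
      ((Measurable.of_discrete (f := g)).comp (measurable_config_apply measurable_snd hx))
  · refine measurable_pi_iff.2 fun w => ?_
    unfold move
    refine ((measurable_pi_iff.1 measurable_snd w).sub (Measurable.ite ?_ measurable_const
      measurable_const)).add (Measurable.ite ?_ measurable_const measurable_const)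
    · exact measurableSet_eq_fun measurable_const hx
    · exact measurableSet_eq_fun measurable_const (hx.add hz)

theorem measurable_interfaceStep (α : ℤ → ℝ) (g : ℕ → ℝ) :
    Measurable fun p : Event × Config × Config × ℤ => interfaceStep α g p.1 p.2 := by
  have h1 : Measurable fun p : Event × Config × Config × ℤ => jump α g p.1 p.2.1 :=
    (measurable_jump α g).comp (measurable_fst.prodMk measurable_snd.fst)
  have h2 : Measurable fun p : Event × Config × Config × ℤ => jump α g p.1 p.2.2.1 :=
    (measurable_jump α g).comp (measurable_fst.prodMk measurable_snd.snd.fst)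
  have h3 : Measurable fun p : Event × Config × Config × ℤ => p.2.2.2 := measurable_snd.snd.snd
  have h4 : Measurable fun p : Event × Config × Config × ℤ => bond p.1 :=
    measurable_bond.comp measurable_fst
  have h5 := h3.add_const 1
  refine h1.prodMk (h2.prodMk (Measurable.ite ?_ h5 (Measurable.ite ?_ (h3.sub_const 1) h3)))
  · exact (measurableSet_eq_fun h4 h3).inter (measurableSet_lt (measurable_config_apply h1 h5)
      (measurable_config_apply h2 h5))
  · exact (measurableSet_eq_fun h4 h3).inter (measurableSet_lt (measurable_config_apply h2 h3)
      (measurable_config_apply h1 h3))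

theorem measurable_walkStep (δ : ℤ) : Measurable fun p : Event × ℤ => walkStep δ p.1 p.2 :=
  Measurable.ite (measurableSet_eq_fun (measurable_bond.comp measurable_fst) measurable_snd)
    (measurable_snd.add_const δ) measurable_snd

end Measurability

/-! ### Event counts of a Harris system -/

section Counts

/-- The number of events in `B` (zero if there are infinitely many). -/
def count {Ω : Type*} (e : ℕ → Ω → Event) (B : Set Event) (ω : Ω) : ℕ := {i | e i ω ∈ B}.ncard

theorem sum_dirac_apply {Ω : Type*} {e : ℕ → Ω → Event} {B : Set Event} (hB : MeasurableSet B) (ω : Ω) :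
    (Measure.sum fun n => Measure.dirac (e n ω)) B = ({i | e i ω ∈ B}.encard : ℝ≥0∞) := by
  rw [Measure.sum_apply _ hB, ← ENNReal.tsum_set_one, tsum_subtype _ (fun _ => (1 : ℝ≥0∞))]
  refine tsum_congr fun i => ?_
  rw [Measure.dirac_apply' _ hB]
  rfl

/-- The floor of `toReal` sends mass `k` to `k` and `∞` to `0`, which matches `ncard` on infinite
sets. Laws and independence thus transfer from the random measure to integer counts. -/
theorem count_eq_floor {Ω : Type*} {e : ℕ → Ω → Event} {B : Set Event} (hB : MeasurableSet B) (ω : Ω) :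
    count e B ω = ⌊((Measure.sum fun n => Measure.dirac (e n ω)) B).toReal⌋₊ := by
  rw [sum_dirac_apply hB, count]
  rcases {i | e i ω ∈ B}.finite_or_infinite with h | h
  · rw [← h.cast_ncard_eq]
    simp
  · rw [h.ncard, h.encard_eq]
    simp

variable {Ω : Type*} [MeasurableSpace Ω] {P : Measure Ω} {p : ℝ} {e : ℕ → Ω → Event}

/-- The events on bond `b` in the time interval `(s, t]`. -/
def window (b : ℤ) (s t : ℝ) : Set Event :=
  {E | (s < E.1 ∧ E.1 ≤ t) ∧ bond E = b ∧ (E.2.2.2 = -1 ∨ E.2.2.2 = 1)}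

theorem measurableSet_window (b : ℤ) (s t : ℝ) : MeasurableSet (window b s t) := by
  have hz : Measurable fun E : Event => E.2.2.2 := measurable_snd.snd.snd
  exact ((measurableSet_lt measurable_const measurable_fst).inter
    (measurableSet_le measurable_fst measurable_const)).inter
    ((measurableSet_eq_fun measurable_bond measurable_const).inter
      ((measurableSet_eq_fun hz measurable_const).union (measurableSet_eq_fun hz measurable_const)))

/-- Bond `b` is crossed by right jumps from `b` at rate `p` and by left jumps from `b + 1` at rate
`1 - p`. The total rate is `1` for every `p`, which is why the dominating processes have intensity
one. -/
theorem harrisIntensity_window (hp0 : 0 ≤ p) (hp1 : p ≤ 1) (b : ℤ) {s t : ℝ≥0} (hst : s ≤ t) :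
    harrisIntensity p (window b s t) = ((t - s : ℝ≥0) : ℝ≥0∞) := by
  have hset : window b s t = Set.Ioc (s : ℝ) t ×ˢ
      (({b} ×ˢ (Set.univ ×ˢ {1})) ∪ ({b + 1} ×ˢ (Set.univ ×ˢ {-1})) : Set (ℤ × ℝ × ℤ)) := by
    ext ⟨τ, x, v, z⟩
    simp only [window, bond, Set.mem_ofPred_eq, Set.mem_prod, Set.mem_Ioc, Set.mem_union,
      Set.mem_singleton_iff, Set.mem_univ, true_and, and_congr_right_iff]
    intro _
    split_ifs <;> omega
  have hdisj : Disjoint ({b} ×ˢ (Set.univ ×ˢ {1}) : Set (ℤ × ℝ × ℤ))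
      ({b + 1} ×ˢ (Set.univ ×ˢ {-1})) := by
    rw [Set.disjoint_left]
    rintro ⟨x, v, z⟩ h1 h2
    simp only [Set.mem_prod, Set.mem_singleton_iff, Set.mem_univ, true_and] at h1 h2
    omega
  have h0 : volume.restrict (Set.Ioi (0 : ℝ)) (Set.Ioc (s : ℝ) t) = ((t - s : ℝ≥0) : ℝ≥0∞) := by
    rw [Measure.restrict_apply measurableSet_Ioc, Set.inter_eq_left.2, Real.volume_Ioc,
      ← NNReal.coe_sub hst, ENNReal.ofReal_coe_nnreal]
    exact fun x hx => lt_of_le_of_lt s.2 hx.1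
  rw [hset, harrisIntensity, Measure.prod_prod, h0, measure_union hdisj
    ((measurableSet_singleton _).prod (MeasurableSet.univ.prod (measurableSet_singleton _))),
    Measure.prod_prod, Measure.prod_prod, Measure.prod_prod, Measure.prod_prod]
  simp [← ENNReal.ofReal_add hp0 (sub_nonneg.2 hp1)]

namespace IsHarrisSystem

theorem measurable_count (he : IsHarrisSystem p e P) {B : Set Event} (hB : MeasurableSet B) :
    Measurable (count e B) := by
  have : count e B = fun ω => ⌊((Measure.sum fun n => Measure.dirac (e n ω)) B).toReal⌋₊ :=
    funext (count_eq_floor hB)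
  rw [this]
  exact Nat.measurable_floor.comp
    (ENNReal.measurable_toReal.comp ((Measure.measurable_coe hB).comp he.poisson.measurable))

theorem map_count (he : IsHarrisSystem p e P) {B : Set Event} (hB : MeasurableSet B)
    (hfin : harrisIntensity p B ≠ ∞) :
    P.map (count e B) = poissonMeasure (harrisIntensity p B).toNNReal := by
  have hφ : Measurable fun x : ℝ≥0∞ => ⌊x.toReal⌋₊ :=
    Nat.measurable_floor.comp ENNReal.measurable_toReal
  have h1 : count e B = (fun x : ℝ≥0∞ => ⌊x.toReal⌋₊) ∘
      fun ω => (Measure.sum fun n => Measure.dirac (e n ω)) B := funext (count_eq_floor hB)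
  have hM : Measurable fun ω => (Measure.sum fun n => Measure.dirac (e n ω)) B :=
    (Measure.measurable_coe hB).comp he.poisson.measurable
  rw [h1, ← Measure.map_map hφ hM,
    he.poisson.law B hB hfin, Measure.map_map hφ Measurable.of_discrete]
  have : (fun x : ℝ≥0∞ => ⌊x.toReal⌋₊) ∘ (fun k : ℕ => (k : ℝ≥0∞)) = id := by
    ext k
    simp
  rw [this, Measure.map_id]

theorem iIndepFun_count (he : IsHarrisSystem p e P) {n : ℕ} {B : Fin n → Set Event}
    (hB : ∀ i, MeasurableSet (B i)) (hd : Pairwise fun i j => Disjoint (B i) (B j)) :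
    iIndepFun (fun i => count e (B i)) P := by
  have hφ : Measurable fun x : ℝ≥0∞ => ⌊x.toReal⌋₊ :=
    Nat.measurable_floor.comp ENNReal.measurable_toReal
  convert (he.poisson.indep n B hB hd).comp (fun _ x => ⌊x.toReal⌋₊) (fun _ => hφ) using 1
  funext i ω
  exact count_eq_floor (hB i) ω

theorem ae_finite (he : IsHarrisSystem p e P) {B : Set Event} (hB : MeasurableSet B)
    (hfin : harrisIntensity p B ≠ ∞) : ∀ᵐ ω ∂P, {i | e i ω ∈ B}.Finite := by
  have hM : Measurable fun ω => (Measure.sum fun n => Measure.dirac (e n ω)) B :=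
    (Measure.measurable_coe hB).comp he.poisson.measurable
  have htop : MeasurableSet {x : ℝ≥0∞ | x ≠ ∞} := (measurableSet_singleton _).compl
  have h1 : ∀ᵐ x ∂(P.map fun ω => (Measure.sum fun n => Measure.dirac (e n ω)) B), x ≠ ∞ := by
    rw [he.poisson.law B hB hfin,
      ae_map_iff Measurable.of_discrete.aemeasurable htop]
    exact Eventually.of_forall fun k => ENNReal.natCast_ne_top k
  rw [ae_map_iff hM.aemeasurable htop] at h1
  filter_upwards [h1] with ω hω
  rw [sum_dirac_apply hB] at hω
  simpa using hω

theorem measure_count_eq (he : IsHarrisSystem p e P) (hp0 : 0 ≤ p) (hp1 : p ≤ 1) (b : ℤ)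
    {s t : ℝ≥0} (hst : s ≤ t) (S : Set ℕ) :
    P {ω | count e (window b s t) ω ∈ S} = poissonMeasure (t - s) S := by
  have hB := measurableSet_window b s t
  have h := he.map_count hB (by rw [harrisIntensity_window hp0 hp1 b hst]; exact ENNReal.coe_ne_top)
  rw [harrisIntensity_window hp0 hp1 b hst, ENNReal.toNNReal_coe] at h
  rw [← h, Measure.map_apply (he.measurable_count hB) .of_discrete]
  rfl

end IsHarrisSystem

theorem disjoint_window_of_ne {b b' : ℤ} (h : b ≠ b') (s t s' t' : ℝ) :
    Disjoint (window b s t) (window b' s' t') :=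
  Set.disjoint_left.2 fun _ h1 h2 => h (h1.2.1.symm.trans h2.2.1)

theorem disjoint_window_of_le {t s' : ℝ} (h : t ≤ s') (b b' : ℤ) (s t' : ℝ) :
    Disjoint (window b s t) (window b' s' t') :=
  Set.disjoint_left.2 fun _ h1 h2 => (h2.1.1.trans_le (h1.1.2.trans h)).false

end Counts

/-! ### Almost every realization of a Harris system is regular -/

section Regular

variable {Ω : Type*} [MeasurableSpace Ω] {P : Measure Ω} {p : ℝ} {e : ℕ → Ω → Event}

/-- From `exp (-r) ≥ 1 - r` one gets `1 - exp (-r) * (1 + r) ≤ r ^ 2`. -/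
theorem poissonMeasure_two_le (r : ℝ≥0) :
    poissonMeasure r {k | 2 ≤ k} ≤ ENNReal.ofReal ((r : ℝ) ^ 2) := by
  have h1 : ({k | 2 ≤ k} : Set ℕ) = ({0, 1} : Set ℕ)ᶜ := by
    ext k
    simp only [Set.mem_ofPred_eq, Set.mem_compl_iff, Set.mem_insert_iff, Set.mem_singleton_iff]
    omega
  have h2 : poissonMeasure r {0, 1} = ENNReal.ofReal (Real.exp (-r) * (1 + r)) := by
    rw [show ({0, 1} : Set ℕ) = {0} ∪ {1} from rfl, measure_union (by simp) (by simp),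
      poissonMeasure_singleton, poissonMeasure_singleton,
      ← ENNReal.ofReal_add (by positivity) (by positivity)]
    congr 1
    simp
    ring
  rw [h1, prob_compl_eq_one_sub .of_discrete, h2, ← ENNReal.ofReal_one,
    ← ENNReal.ofReal_sub _ (by positivity)]
  refine ENNReal.ofReal_le_ofReal ?_
  have := Real.add_one_le_exp (-(r : ℝ))
  have hr : (0 : ℝ) ≤ r := r.2
  nlinarith

namespace IsHarrisSystem

theorem valid (he : IsHarrisSystem p e P) (ω : Ω) (i : ℕ) : IsValid (e i ω) := he.mem i ω

theorem mem_window_iff (he : IsHarrisSystem p e P) (ω : Ω) (i : ℕ) (b : ℤ) (s t : ℝ) :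
    e i ω ∈ window b s t ↔ (s < (e i ω).1 ∧ (e i ω).1 ≤ t) ∧ bond (e i ω) = b := by
  have := (he.valid ω i).2.2
  simp only [window, Set.mem_ofPred_eq, this, and_true]

theorem ae_finite_window (he : IsHarrisSystem p e P) (hp0 : 0 ≤ p) (hp1 : p ≤ 1) :
    ∀ᵐ ω ∂P, ∀ (b : ℤ) (T : ℝ), {i | bond (e i ω) = b ∧ (e i ω).1 ≤ T}.Finite := by
  have h : ∀ᵐ ω ∂P, ∀ (b : ℤ) (n : ℕ), {i | e i ω ∈ window b (0 : ℝ≥0) (n : ℝ≥0)}.Finite := by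
    refine ae_all_iff.2 fun b => ae_all_iff.2 fun n => he.ae_finite (measurableSet_window _ _ _) ?_
    rw [harrisIntensity_window hp0 hp1 b (by simp)]
    exact ENNReal.coe_ne_top
  filter_upwards [h] with ω hω b T
  obtain ⟨n, hn⟩ := exists_nat_ge T
  refine (hω b n).subset fun i hi => ?_
  exact (he.mem_window_iff ω i b _ _).2
    ⟨⟨by simpa using (he.valid ω i).1, by simpa using hi.2.trans hn⟩, hi.1⟩

/-- Along any sequence of distinct bonds there is one without events up to time `n`. -/
theorem ae_exists_empty (he : IsHarrisSystem p e P) [IsProbabilityMeasure P] (hp0 : 0 ≤ p)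
    (hp1 : p ≤ 1) {f : ℕ → ℤ} (hf : Function.Injective f) (T : ℝ≥0) :
    ∀ᵐ ω ∂P, ∃ j, count e (window (f j) (0 : ℝ≥0) T) ω = 0 := by
  set c : ℝ≥0∞ := poissonMeasure T {0}ᶜ with hc
  have hc1 : c < 1 := by
    rw [hc, prob_compl_eq_one_sub .of_discrete]
    refine ENNReal.sub_lt_self ENNReal.one_ne_top one_ne_zero ?_
    rw [poissonMeasure_singleton]
    simp [Real.exp_pos]
  rw [ae_iff]
  -- Windows on distinct bonds are independent, so the first `n` of them are all nonempty with
  -- probability `c ^ n`.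
  refine le_antisymm (ge_of_tendsto' (ENNReal.tendsto_pow_atTop_nhds_zero_of_lt_one hc1)
    fun n => ?_) zero_le
  have hind : iIndepFun (fun i : Fin n => count e (window (f i) (0 : ℝ≥0) T)) P :=
    he.iIndepFun_count (fun i => measurableSet_window _ _ _)
      fun i j hij => disjoint_window_of_ne (fun h => hij (Fin.ext (hf h))) _ _ _ _
  have h2 := (iIndepFun_iff_measure_inter_preimage_eq_mul.1 hind) Finset.univ
    (sets := fun _ => {0}ᶜ) (fun _ _ => .of_discrete)
  have h3 : ∀ i : Fin n, P (count e (window (f i) (0 : ℝ≥0) T) ⁻¹' {0}ᶜ) = c := fun i => by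
    have := he.measure_count_eq hp0 hp1 (f i) (zero_le : (0 : ℝ≥0) ≤ T) {0}ᶜ
    rw [tsub_zero] at this
    exact this
  simp only [h3, Finset.prod_const, Finset.card_univ, Fintype.card_fin] at h2
  rw [← h2]
  refine measure_mono fun ω hω => ?_
  simp only [Set.mem_ofPred_eq, not_exists] at hω
  simpa using fun i : Fin n => hω i

theorem not_bond_of_count_eq_zero (he : IsHarrisSystem p e P) {ω : Ω} {b : ℤ} {T : ℝ≥0}
    (hfin : {i | bond (e i ω) = b ∧ (e i ω).1 ≤ T}.Finite)
    (h : count e (window b (0 : ℝ≥0) T) ω = 0) (i : ℕ) (hi : (e i ω).1 ≤ T) : bond (e i ω) ≠ b := by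
  intro hb
  rw [count, Set.ncard_eq_zero (hfin.subset fun i hi => ?_)] at h
  · have : i ∈ {i | e i ω ∈ window b (0 : ℝ≥0) T} :=
      (he.mem_window_iff ω i b _ _).2 ⟨⟨by simpa using (he.valid ω i).1, hi⟩, hb⟩
    rw [h] at this
    exact this
  · have := (he.mem_window_iff ω i b _ _).1 hi
    exact ⟨this.2, this.1.2⟩

theorem measure_two_le_count (he : IsHarrisSystem p e P) {B : Set Event} (hB : MeasurableSet B)
    {r : ℝ≥0} (hr : harrisIntensity p B ≤ r) :
    P {ω | 2 ≤ count e B ω} ≤ ENNReal.ofReal ((r : ℝ) ^ 2) := by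
  have hfin : harrisIntensity p B ≠ ∞ := (hr.trans_lt ENNReal.coe_lt_top).ne
  have h := he.map_count hB hfin
  calc P {ω | 2 ≤ count e B ω} = P.map (count e B) {k | 2 ≤ k} := by
        rw [Measure.map_apply (he.measurable_count hB) .of_discrete]; rfl
    _ = poissonMeasure (harrisIntensity p B).toNNReal {k | 2 ≤ k} := by rw [h]
    _ ≤ _ := poissonMeasure_two_le _
    _ ≤ _ := by
        refine ENNReal.ofReal_le_ofReal ?_
        gcongr
        simpa using ENNReal.toNNReal_mono ENNReal.coe_ne_top hr

/-- Events on the bonds `-K, …, K` occur at distinct times. -/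
theorem ae_inj_of_le (he : IsHarrisSystem p e P) (hp0 : 0 ≤ p) (hp1 : p ≤ 1) (K T : ℕ) :
    ∀ᵐ ω ∂P, ∀ i j, |bond (e i ω)| ≤ K → |bond (e j ω)| ≤ K → (e i ω).1 ≤ T →
      (e i ω).1 = (e j ω).1 → i = j := by
  let B : ℕ → ℕ → Set Event := fun n q =>
    ⋃ b ∈ Finset.Icc (-(K : ℤ)) K, window b ((q / (n + 1) : ℝ≥0)) (((q + 1) / (n + 1) : ℝ≥0))
  have hBm : ∀ n q, MeasurableSet (B n q) := fun n q =>
    Finset.measurableSet_biUnion _ fun b _ => measurableSet_window _ _ _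
  have hBi : ∀ n q, harrisIntensity p (B n q) ≤ (((2 * K + 1) / (n + 1) : ℝ≥0) : ℝ≥0∞) := by
    intro n q
    refine (measure_biUnion_finset_le _ _).trans ?_
    have hle : (q / (n + 1) : ℝ≥0) ≤ (q + 1) / (n + 1) := by gcongr; simp
    simp only [harrisIntensity_window hp0 hp1 _ hle, Finset.sum_const, Int.card_Icc]
    have h1 : ((q + 1) / (n + 1) - q / (n + 1) : ℝ≥0) = 1 / (n + 1) := by
      rw [← NNReal.sub_div, add_tsub_cancel_left]
    have h2 : ((K : ℤ) + 1 - -(K : ℤ)).toNat = 2 * K + 1 := by omega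
    rw [h1, h2, nsmul_eq_mul, ← ENNReal.coe_natCast, ← ENNReal.coe_mul]
    refine ENNReal.coe_le_coe.2 (le_of_eq ?_)
    push_cast
    ring
  have hfin := he.ae_finite_window hp0 hp1
  -- Union bound: `(n + 1) * T` slots, each with two or more events with probability at most `((2 *
  -- K + 1) / (n + 1)) ^ 2`; the sum is of order `1 / (n + 1)`.
  have key : P {ω | ∀ n, ∃ q ∈ Finset.range ((n + 1) * T), 2 ≤ count e (B n q) ω} = 0 := by
    have hlim : Tendsto (fun n : ℕ => ENNReal.ofReal ((T * (2 * K + 1) ^ 2 : ℝ) * (1 / (n + 1))))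
        atTop (𝓝 0) := by
      rw [← ENNReal.ofReal_zero]
      refine ENNReal.tendsto_ofReal ?_
      simpa using (tendsto_one_div_add_atTop_nhds_zero_nat (𝕜 := ℝ)).const_mul
        (T * (2 * K + 1) ^ 2 : ℝ)
    refine le_antisymm (ge_of_tendsto' hlim fun n => ?_) zero_le
    calc _ ≤ P (⋃ q ∈ Finset.range ((n + 1) * T), {ω | 2 ≤ count e (B n q) ω}) := by
          refine measure_mono fun ω hω => ?_
          obtain ⟨q, hq, h⟩ := hω n
          exact Set.mem_biUnion hq h
      _ ≤ ∑ q ∈ Finset.range ((n + 1) * T), P {ω | 2 ≤ count e (B n q) ω} :=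
          measure_biUnion_finset_le _ _
      _ ≤ ∑ q ∈ Finset.range ((n + 1) * T),
            ENNReal.ofReal ((((2 * K + 1) / (n + 1) : ℝ≥0) : ℝ) ^ 2) :=
          Finset.sum_le_sum fun q _ => he.measure_two_le_count (hBm n q) (hBi n q)
      _ = _ := by
          rw [Finset.sum_const, Finset.card_range, nsmul_eq_mul, ← ENNReal.ofReal_natCast,
            ← ENNReal.ofReal_mul (by positivity)]
          congr 1
          push_cast
          field_simp
  have key' : ∀ᵐ ω ∂P, ¬ ∀ n, ∃ q ∈ Finset.range ((n + 1) * T), 2 ≤ count e (B n q) ω := by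
    rw [ae_iff]
    simpa only [not_not] using key
  filter_upwards [key', hfin] with ω hω hfinω i j hi hj hiT hij
  by_contra hne
  refine hω fun n => ?_
  have hn : (0 : ℝ) < n + 1 := by positivity
  have hti := (he.valid ω i).1
  -- Ceiling minus one rather than the floor, because windows are open on the left and closed on the
  -- right.
  set q := ⌈(e i ω).1 * (n + 1)⌉₊ - 1 with hq
  have hpos : 0 < ⌈(e i ω).1 * (n + 1)⌉₊ := Nat.ceil_pos.2 (by positivity)
  have hq1 : ((q : ℝ) + 1) = ⌈(e i ω).1 * (n + 1)⌉₊ := by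
    rw [hq]
    exact_mod_cast Nat.sub_add_cancel hpos
  have hlo : (q : ℝ) < (e i ω).1 * (n + 1) := by
    have := Nat.ceil_lt_add_one (a := (e i ω).1 * (n + 1)) (by positivity)
    linarith
  have hhi : (e i ω).1 * (n + 1) ≤ q + 1 := hq1 ▸ Nat.le_ceil _
  have hmem : ∀ k, |bond (e k ω)| ≤ K → (e k ω).1 = (e i ω).1 → e k ω ∈ B n q := by
    intro k hk hki
    simp only [B, Set.mem_iUnion]
    refine ⟨bond (e k ω), by simpa [abs_le] using hk, (he.mem_window_iff ω k _ _ _).2 ⟨?_, rfl⟩⟩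
    rw [hki]
    push_cast
    exact ⟨by rwa [div_lt_iff₀ hn], by rwa [le_div_iff₀ hn]⟩
  have hsub : ({i, j} : Set ℕ) ⊆ {k | e k ω ∈ B n q} := by
    rintro k (rfl | rfl)
    · exact hmem k hi rfl
    · exact hmem k hj hij.symm
  refine ⟨q, ?_, ?_⟩
  · rw [Finset.mem_range]
    have : (q : ℝ) < ((n + 1) * T : ℕ) := by
      push_cast
      nlinarith
    exact_mod_cast this
  · rw [count, ← Set.ncard_pair hne]
    -- Finiteness of the larger set is essential, as `ncard` of an infinite set is `0`.
    refine Set.ncard_le_ncard hsub ?_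
    have : {k | e k ω ∈ B n q} ⊆ ⋃ b ∈ Finset.Icc (-(K : ℤ)) K,
        {k | bond (e k ω) = b ∧ (e k ω).1 ≤ ((q + 1) / (n + 1) : ℝ≥0)} := by
      intro k hk
      simp only [B, Set.mem_iUnion, Set.mem_ofPred_eq] at hk ⊢
      obtain ⟨b, hb, hk⟩ := hk
      have := (he.mem_window_iff ω k _ _ _).1 hk
      exact ⟨b, hb, this.2, this.1.2⟩
    exact (Set.Finite.biUnion (Finset.finite_toSet _) fun b _ => hfinω b _).subset this

theorem ae_isRegular (he : IsHarrisSystem p e P) [IsProbabilityMeasure P] (hp0 : 0 ≤ p)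
    (hp1 : p ≤ 1) : ∀ᵐ ω ∂P, IsRegular fun i => e i ω := by
  have hr : ∀ᵐ ω ∂P, ∀ (T : ℕ) (k : ℤ), ∃ j : ℕ,
      count e (window (k + j) (0 : ℝ≥0) (T : ℝ≥0)) ω = 0 :=
    ae_all_iff.2 fun T => ae_all_iff.2 fun k => he.ae_exists_empty hp0 hp1
      (f := fun j => k + j) (fun i j h => by simpa using h) T
  have hl : ∀ᵐ ω ∂P, ∀ (T : ℕ) (k : ℤ), ∃ j : ℕ,
      count e (window (k - j) (0 : ℝ≥0) (T : ℝ≥0)) ω = 0 :=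
    ae_all_iff.2 fun T => ae_all_iff.2 fun k => he.ae_exists_empty hp0 hp1
      (f := fun j => k - j) (fun i j h => by simpa using h) T
  have hinj : ∀ᵐ ω ∂P, ∀ K T : ℕ, ∀ i j, |bond (e i ω)| ≤ K → |bond (e j ω)| ≤ K →
      (e i ω).1 ≤ T → (e i ω).1 = (e j ω).1 → i = j :=
    ae_all_iff.2 fun K => ae_all_iff.2 fun T => he.ae_inj_of_le hp0 hp1 K T
  filter_upwards [hr, hl, hinj, he.ae_finite_window hp0 hp1] with ω hr hl hinj hfin
  refine ⟨he.valid ω, fun i j hij => ?_, hfin, fun T k => ?_, fun T k => ?_⟩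
  · obtain ⟨T, hT⟩ := exists_nat_ge (e i ω).1
    refine hinj (max (bond (e i ω)).natAbs (bond (e j ω)).natAbs) T i j ?_ ?_ hT hij <;>
    · rw [Int.abs_eq_natAbs]
      exact_mod_cast (by simp)
  · obtain ⟨n, hn⟩ := exists_nat_ge T
    obtain ⟨j, hj⟩ := hr n k
    exact ⟨k + j, by simp, fun i hi =>
      he.not_bond_of_count_eq_zero (hfin _ _) hj i (by simpa using hi.trans hn)⟩
  · obtain ⟨n, hn⟩ := exists_nat_ge T
    obtain ⟨j, hj⟩ := hl n k
    exact ⟨k - j, by simp, fun i hi =>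
      he.not_bond_of_count_eq_zero (hfin _ _) hj i (by simpa using hi.trans hn)⟩

end IsHarrisSystem

end Regular

/-! ### Independence and Poisson laws -/

section Independence

theorem iIndepFun_of_forall_fin {Ω β : Type*} [MeasurableSpace Ω] {P : Measure Ω}
    [MeasurableSpace β] {X : ℕ → Ω → β}
    (h : ∀ n, iIndepFun (fun i : Fin n => X i) P) : iIndepFun X P := by
  refine iIndepFun_iff_finset.2 fun s => ?_
  obtain ⟨n, hn⟩ := s.exists_nat_subset_range
  let f (x : s) : Fin n := ⟨x.1, Finset.mem_range.1 (hn x.2)⟩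
  refine iIndepFun.precomp (g := f) ?_ (h n)
  intro x y hxy
  exact Subtype.ext (by simpa [f] using hxy)

variable {Ω : Type*} [MeasurableSpace Ω] {P : Measure Ω} [IsProbabilityMeasure P]

/-- Independence means that the joint law is a product measure, and currying turns a product over
pairs into a product of products. -/
theorem iIndepFun_curry {ι κ β : Type*} [MeasurableSpace β] {X : ι → κ → Ω → β}
    (mX : ∀ i j, Measurable (X i j)) (h : iIndepFun (fun (q : ι × κ) ω => X q.1 q.2 ω) P) :
    iIndepFun (fun i ω j => X i j ω) P := by
  have hprob : ∀ i j, IsProbabilityMeasure (P.map (X i j)) :=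
    fun i j => Measure.isProbabilityMeasure_map (mX i j).aemeasurable
  have h1 := (iIndepFun_iff_map_fun_eq_infinitePi_map (fun q : ι × κ => mX q.1 q.2)).1 h
  have h2 : ∀ i, P.map (fun ω j => X i j ω) = Measure.infinitePi fun j => P.map (X i j) := fun i =>
    (iIndepFun_iff_map_fun_eq_infinitePi_map (mX i)).1
      (h.precomp (g := fun j => (i, j)) (fun _ _ hj => by simpa using hj))
  rw [iIndepFun_iff_map_fun_eq_infinitePi_map (fun i => measurable_pi_iff.2 (mX i))]
  simp only [h2]
  have hm : Measurable fun ω (q : ι × κ) => X q.1 q.2 ω :=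
    measurable_pi_iff.2 fun q => mX q.1 q.2
  rw [← Measure.infinitePi_map_curry (fun i j => P.map (X i j)), ← h1,
    Measure.map_map (MeasurableEquiv.measurable _) hm]
  rfl

theorem iIndepFun_block_sum {X : ℕ → Ω → ℕ} (mX : ∀ i, Measurable (X i)) (h : iIndepFun X P)
    (m : ℕ) : iIndepFun (fun q ω => ∑ r ∈ Finset.range m, X (q * m + r) ω) P := by
  have hinj : Function.Injective fun q : ℕ × Fin m => q.1 * m + q.2 := by
    rintro ⟨q, r⟩ ⟨q', r'⟩ hq
    simp only at hq
    have hm : 0 < m := r.pos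
    have h1 : (q * m + r) / m = q := by
      rw [mul_comm, Nat.mul_add_div hm, Nat.div_eq_of_lt r.2, add_zero]
    have h2 : (q' * m + r') / m = q' := by
      rw [mul_comm, Nat.mul_add_div hm, Nat.div_eq_of_lt r'.2, add_zero]
    have h3 : q = q' := by rw [← h1, ← h2, hq]
    subst h3
    simp only [Prod.mk.injEq, true_and]
    exact Fin.ext (by omega)
  have h1 := iIndepFun_curry (X := fun q (r : Fin m) => X (q * m + r)) (fun q r => mX _)
    (h.precomp hinj)
  convert h1.comp (fun _ f => ∑ r, f r)
    (fun _ => Finset.measurable_fun_sum _ fun r _ => measurable_pi_apply r) using 1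
  funext q ω
  exact Finset.sum_range _

theorem poissonMeasure_zero : poissonMeasure 0 = Measure.dirac 0 := by
  refine Measure.ext_of_singleton fun k => ?_
  rw [poissonMeasure_singleton]
  rcases eq_or_ne k 0 with rfl | hk
  · simp
  · simp [hk, Ne.symm hk]

theorem map_sum_poisson {X : ℕ → Ω → ℕ} (mX : ∀ i, Measurable (X i)) (h : iIndepFun X P)
    {r : ℕ → ℝ≥0} (hr : ∀ i, P.map (X i) = poissonMeasure (r i)) (n : ℕ) :
    P.map (fun ω => ∑ i ∈ Finset.range n, X i ω) = poissonMeasure (∑ i ∈ Finset.range n, r i) := by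
  induction n with
  | zero => simp [poissonMeasure_zero]
  | succ n ih =>
    have h1 : HasLaw (∑ i ∈ Finset.range n, X i) (poissonMeasure (∑ i ∈ Finset.range n, r i)) P :=
      ⟨(Finset.aemeasurable_sum _ fun i _ => (mX i).aemeasurable), by
        rw [← ih]; congr 1; ext ω; simp⟩
    have h2 := (h.indepFun_sum_range_succ mX n).hasLaw_add_poissonMeasure h1
      ⟨(mX n).aemeasurable, hr n⟩
    rw [Finset.sum_range_succ, ← h2.map_eq]
    congr 1
    ext ω
    simp [Finset.sum_range_succ]

/-- Eventual equality makes indicators converge almost surely, hence probabilities converge; here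
they are constant in `m`. -/
theorem map_eq_of_eventually_eq {β : Type*} [MeasurableSpace β] {Y : ℕ → Ω → β} {Z : Ω → β}
    (hY : ∀ m, Measurable (Y m)) (hZ : Measurable Z) {μ : Measure β}
    (hμ : ∀ m, P.map (Y m) = μ) (h : ∀ᵐ ω ∂P, ∀ᶠ m in atTop, Y m ω = Z ω) : P.map Z = μ := by
  ext S hS
  have h1 : Tendsto (fun m => P (Y m ⁻¹' S)) atTop (𝓝 (P (Z ⁻¹' S))) := by
    refine tendsto_measure_of_ae_tendsto_indicator_of_isFiniteMeasure _ (hZ hS)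
      (fun m => hY m hS) ?_
    filter_upwards [h] with ω hω
    filter_upwards [hω] with m hm
    rw [Set.mem_preimage, Set.mem_preimage, hm]
  have h2 : ∀ m, P (Y m ⁻¹' S) = μ S := fun m => by rw [← hμ m, Measure.map_apply (hY m) hS]
  simp only [h2] at h1
  rw [Measure.map_apply hZ hS]
  exact tendsto_nhds_unique h1 tendsto_const_nhds

theorem iIndepFun_and_map_of_map_eq_pi {n : ℕ} {X : Fin n → Ω → ℕ} (mX : ∀ i, Measurable (X i))
    {μ : Fin n → Measure ℕ} [∀ i, IsProbabilityMeasure (μ i)]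
    (h : P.map (fun ω i => X i ω) = Measure.pi μ) :
    iIndepFun X P ∧ ∀ i, P.map (X i) = μ i := by
  have h1 : ∀ i, P.map (X i) = μ i := fun i => by
    rw [← (measurePreserving_eval μ i).map_eq, ← h,
      Measure.map_map (measurable_pi_apply i) (measurable_pi_iff.2 mX)]
    rfl
  refine ⟨(iIndepFun_iff_map_fun_eq_pi_map fun i => (mX i).aemeasurable).2 ?_, h1⟩
  simp only [h1, h]

end Independence

/-! ### Walks on a time grid -/

section Grid

variable {Ω : Type*}

/-- A walk which, in each slot of the time grid `τ`, makes as many steps `δ` as there are events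
on the bond at which it is found at the beginning of the slot. -/
def gridWalk (e : ℕ → Ω → Event) (δ a : ℤ) (τ : ℕ → ℝ≥0) (ω : Ω) : ℕ → ℤ
  | 0 => a
  | j + 1 => gridWalk e δ a τ ω j +
      δ * count e (window (gridWalk e δ a τ ω j) (τ j) (τ (j + 1))) ω

/-- The number of steps of `gridWalk` in a slot. -/
def gridStep (e : ℕ → Ω → Event) (δ a : ℤ) (τ : ℕ → ℝ≥0) (j : ℕ) (ω : Ω) : ℕ :=
  count e (window (gridWalk e δ a τ ω j) (τ j) (τ (j + 1))) ω

theorem gridWalk_eq (e : ℕ → Ω → Event) (δ a : ℤ) (τ : ℕ → ℝ≥0) (ω : Ω) (j : ℕ) :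
    gridWalk e δ a τ ω j = a + δ * ∑ i ∈ Finset.range j, (gridStep e δ a τ i ω : ℤ) := by
  induction j with
  | zero => simp [gridWalk]
  | succ j ih =>
    rw [Finset.sum_range_succ, mul_add, ← add_assoc, ← ih]
    rfl

/-- Prescribing the step numbers fixes the positions, so the randomly chosen windows become
deterministic ones. This elementary fact takes the place of a Markov property. -/
theorem gridStep_eq_iff (e : ℕ → Ω → Event) (δ a : ℤ) (τ : ℕ → ℝ≥0) (ω : Ω) (d : ℕ → ℕ) (n : ℕ) :
    (∀ j < n, gridStep e δ a τ j ω = d j) ↔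
      ∀ j < n, count e (window (a + δ * ∑ i ∈ Finset.range j, (d i : ℤ)) (τ j) (τ (j + 1))) ω =
        d j := by
  induction n with
  | zero => simp
  | succ n ih =>
    rw [Nat.forall_lt_succ_right, Nat.forall_lt_succ_right, ← ih]
    refine and_congr_right fun h => ?_
    rw [gridStep, gridWalk_eq, Finset.sum_congr rfl fun i hi => by rw [h i (Finset.mem_range.1 hi)]]

variable [MeasurableSpace Ω] {P : Measure Ω} {p : ℝ} {e : ℕ → Ω → Event}

namespace IsHarrisSystem

theorem measurable_count_window (he : IsHarrisSystem p e P) (s t : ℝ) {w : Ω → ℤ}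
    (hw : Measurable w) : Measurable fun ω => count e (window (w ω) s t) ω := by
  intro S hS
  have : (fun ω => count e (window (w ω) s t) ω) ⁻¹' S =
      ⋃ b : ℤ, w ⁻¹' {b} ∩ count e (window b s t) ⁻¹' S := by
    ext ω
    simp
  rw [this]
  exact MeasurableSet.iUnion fun b => (hw (measurableSet_singleton b)).inter
    (he.measurable_count (measurableSet_window b s t) hS)

theorem measurable_gridWalk (he : IsHarrisSystem p e P) (δ a : ℤ) (τ : ℕ → ℝ≥0) (j : ℕ) :
    Measurable fun ω => gridWalk e δ a τ ω j := by
  induction j with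
  | zero =>
    simp only [gridWalk]
    exact measurable_const
  | succ j ih =>
    simp only [gridWalk]
    refine ih.add ?_
    exact (Measurable.of_discrete (f := fun k : ℕ => δ * (k : ℤ))).comp
      (he.measurable_count_window _ _ ih)

theorem measurable_gridStep (he : IsHarrisSystem p e P) (δ a : ℤ) (τ : ℕ → ℝ≥0) (j : ℕ) :
    Measurable (gridStep e δ a τ j) :=
  he.measurable_count_window _ _ (he.measurable_gridWalk δ a τ j)

/-- For each prescribed vector `d` the event is an intersection of conditions on disjoint
deterministic windows. Its probability factorizes, with factors that depend on slot lengths but not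
on positions. -/
theorem map_gridStep [IsProbabilityMeasure P] (he : IsHarrisSystem p e P) (hp0 : 0 ≤ p)
    (hp1 : p ≤ 1) (δ a : ℤ) {τ : ℕ → ℝ≥0} (hτ : Monotone τ) (n : ℕ) :
    P.map (fun ω (j : Fin n) => gridStep e δ a τ j ω) =
      Measure.pi fun j : Fin n => poissonMeasure (τ (j + 1) - τ j) := by
  refine Measure.ext_of_singleton fun d => ?_
  let d' : ℕ → ℕ := fun j => if h : j < n then d ⟨j, h⟩ else 0
  have hd : ∀ j : Fin n, d' j = d j := fun j => by simp [d']
  let w : ℕ → ℤ := fun j => a + δ * ∑ i ∈ Finset.range j, (d' i : ℤ)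
  have hind : iIndepFun (fun j : Fin n => count e (window (w j) (τ j) (τ (j + 1)))) P := by
    refine he.iIndepFun_count (fun j => measurableSet_window _ _ _) fun i j hij => ?_
    rcases lt_or_gt_of_ne hij with h | h
    · exact disjoint_window_of_le (by exact_mod_cast hτ (Nat.succ_le_of_lt h)) _ _ _ _
    · exact (disjoint_window_of_le (by exact_mod_cast hτ (Nat.succ_le_of_lt h)) _ _ _ _).symm
  have h2 := (iIndepFun_iff_measure_inter_preimage_eq_mul.1 hind) Finset.univ
    (sets := fun j => {d j}) (fun _ _ => .of_discrete)
  have h3 : ∀ j : Fin n, P (count e (window (w j) (τ j) (τ (j + 1))) ⁻¹' {d j}) =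
      poissonMeasure (τ (j + 1) - τ j) {d j} := fun j =>
    he.measure_count_eq hp0 hp1 (w j) (hτ (Nat.le_succ j)) {d j}
  rw [Measure.pi_singleton, Measure.map_apply
    (measurable_pi_iff.2 fun j : Fin n => he.measurable_gridStep δ a τ j) .of_discrete]
  simp only [h3] at h2
  rw [← h2]
  congr 1
  ext ω
  simp only [Set.mem_preimage, Set.mem_singleton_iff, Finset.mem_univ, Set.iInter_true,
    Set.mem_iInter]
  rw [funext_iff]
  have := gridStep_eq_iff e δ a τ ω d' n
  constructor
  · intro h j
    rw [← hd j]
    exact this.1 (fun i hi => by rw [h ⟨i, hi⟩, ← hd ⟨i, hi⟩]) j j.2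
  · intro h j
    rw [← hd j]
    exact this.2 (fun i hi => by rw [hd ⟨i, hi⟩]; exact h ⟨i, hi⟩) j j.2

theorem iIndepFun_gridStep [IsProbabilityMeasure P] (he : IsHarrisSystem p e P) (hp0 : 0 ≤ p)
    (hp1 : p ≤ 1) (δ a : ℤ) {τ : ℕ → ℝ≥0} (hτ : Monotone τ) :
    iIndepFun (gridStep e δ a τ) P ∧
      ∀ j, P.map (gridStep e δ a τ j) = poissonMeasure (τ (j + 1) - τ j) := by
  have h := fun n => iIndepFun_and_map_of_map_eq_pi
    (fun j : Fin n => he.measurable_gridStep δ a τ j) (he.map_gridStep hp0 hp1 δ a hτ n)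
  exact ⟨iIndepFun_of_forall_fin fun n => (h n).1, fun j => (h (j + 1)).2 (Fin.last j)⟩

end IsHarrisSystem

/-- The time grid that divides each interval `[t q, t (q + 1)]` into `m` slots. -/
def subdivision (t : ℕ → ℝ≥0) (m j : ℕ) : ℝ≥0 :=
  ∑ i ∈ Finset.range j, (t (i / m + 1) - t (i / m)) / m

theorem monotone_subdivision (t : ℕ → ℝ≥0) (m : ℕ) : Monotone (subdivision t m) :=
  monotone_nat_of_le_succ fun j => by
    rw [subdivision, subdivision, Finset.sum_range_succ]
    exact le_self_add

theorem subdivision_mul {t : ℕ → ℝ≥0} (ht : Monotone t) (h0 : t 0 = 0) {m : ℕ} (hm : 0 < m)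
    (q : ℕ) : subdivision t m (q * m) = t q := by
  induction q with
  | zero => simp [subdivision, h0]
  | succ q ih =>
    rw [subdivision, Nat.succ_mul, Finset.sum_range_add, ← subdivision, ih]
    have : ∀ r ∈ Finset.range m, (t ((q * m + r) / m + 1) - t ((q * m + r) / m)) / (m : ℝ≥0) =
        (t (q + 1) - t q) / m := fun r hr => by
      rw [mul_comm q m, Nat.mul_add_div hm, Nat.div_eq_of_lt (Finset.mem_range.1 hr), add_zero]
    rw [Finset.sum_congr rfl this, Finset.sum_const, Finset.card_range, nsmul_eq_mul,
      mul_div_cancel₀ _ (by exact_mod_cast hm.ne'), add_tsub_cancel_of_le (ht (Nat.le_succ q))]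

theorem subdivision_succ_sub_le {t : ℕ → ℝ≥0} (ht : Monotone t) {m K j : ℕ} (hj : j < K * m) :
    subdivision t m (j + 1) ≤ subdivision t m j + t K / m := by
  rw [subdivision, Finset.sum_range_succ, ← subdivision]
  gcongr
  exact tsub_le_self.trans (ht (Nat.succ_le_of_lt (Nat.div_lt_of_lt_mul (by rwa [mul_comm]))))

/-- The increments of the grid walk over the intervals `[t q, t (q + 1)]`. -/
def gridIncrement (e : ℕ → Ω → Event) (δ a : ℤ) (t : ℕ → ℝ≥0) (m q : ℕ) (ω : Ω) : ℕ :=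
  ∑ r ∈ Finset.range m, gridStep e δ a (subdivision t m) (q * m + r) ω

theorem IsHarrisSystem.map_gridIncrement [IsProbabilityMeasure P] (he : IsHarrisSystem p e P)
    (hp0 : 0 ≤ p) (hp1 : p ≤ 1) (δ a : ℤ) {t : ℕ → ℝ≥0} (ht : Monotone t) (h0 : t 0 = 0) {m : ℕ}
    (hm : 0 < m) (n : ℕ) : P.map (fun ω (q : Fin n) => gridIncrement e δ a t m q ω) =
      Measure.pi fun q : Fin n => poissonMeasure (t (q + 1) - t q) := by
  obtain ⟨h1, h2⟩ := he.iIndepFun_gridStep hp0 hp1 δ a (monotone_subdivision t m)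
  have hms := fun j => he.measurable_gridStep δ a (subdivision t m) j
  have h3 : iIndepFun (gridIncrement e δ a t m) P := iIndepFun_block_sum hms h1 m
  have hmi : ∀ q, Measurable (gridIncrement e δ a t m q) := fun q =>
    Finset.measurable_fun_sum _ fun r _ => hms _
  have h6 : iIndepFun (fun q : Fin n => gridIncrement e δ a t m q) P := h3.precomp Fin.val_injective
  rw [h6.map_fun_eq_pi_map fun q : Fin n => (hmi q).aemeasurable]
  congr 1
  funext q
  have h4 := map_sum_poisson (X := fun r => gridStep e δ a (subdivision t m) (q * m + r))
    (fun r => hms _) (h1.precomp (add_right_injective _)) (fun r => h2 _) m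
  refine h4.trans ?_
  congr 1
  have h5 := Finset.sum_range_tsub (f := fun r => subdivision t m (q * m + r))
    ((monotone_subdivision t m).comp (fun a b hab => by simpa using hab)) m
  rw [show ((q : ℕ) + 1) = Nat.succ q from rfl, ← subdivision_mul ht h0 hm (Nat.succ q),
    ← subdivision_mul ht h0 hm (q : ℕ), Nat.succ_mul]
  exact h5

end Grid

/-! ### The dominating walks are Poisson processes -/

section PoissonWalk

/-- With at most one block event in the slot, the walk cannot meet a second event after stepping, so
counting on the bond occupied at the start is exact. -/
theorem IsRegular.run_walkStep_slot {Ω : Type*} {e : ℕ → Ω → Event} {ω : Ω}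
    (h : IsRegular fun i => e i ω) (δ : ℤ) {T : ℝ} {A B : ℤ}
    (hb : IsBlock (fun i => e i ω) T A B) {l : List ℕ}
    (hl : IsBlockList (fun i => e i ω) T A B l) {s s' : ℝ} (hs : s ≤ s') (hs' : s' ≤ T)
    (hsep : ∀ i ∈ l, ∀ j ∈ l, s < (e i ω).1 → (e i ω).1 ≤ s' → s < (e j ω).1 → (e j ω).1 ≤ s' →
      i = j) {a w : ℤ} (hw : run (walkStep δ) (fun i => e i ω) l s a = w) (hA : A ≤ w)
    (hB : w ≤ B) :
    run (walkStep δ) (fun i => e i ω) l s' a = w + δ * count e (window w s s') ω := by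
  have hmem : ∀ i, e i ω ∈ window w s s' ↔ (s < (e i ω).1 ∧ (e i ω).1 ≤ s') ∧ bond (e i ω) = w := by
    intro i
    have := (h.valid i).2.2
    simp only [window, Set.mem_ofPred_eq, this, and_true]
  -- The walk may sit at `A` or `B`, but those bonds are silent, so an event on its bond is an inner
  -- one.
  have hin : ∀ i, e i ω ∈ window w s s' → i ∈ l := by
    intro i hi
    rw [hmem] at hi
    have hT := hi.1.2.trans hs'
    have : bond (e i ω) ≠ A ∧ bond (e i ω) ≠ B := hb i hT
    exact (hl.mem_iff i).2 ⟨by show A < bond (e i ω) ∧ bond (e i ω) < B; omega, hT⟩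
  by_cases hex : ∃ i ∈ l, s < (e i ω).1 ∧ (e i ω).1 ≤ s'
  · obtain ⟨i, hi, h1, h2⟩ := hex
    have e1 : run (walkStep δ) (fun i => e i ω) l s' a =
        run (walkStep δ) (fun i => e i ω) l (e i ω).1 a := by
      refine run_eq_of_forall_not hl.pairwise h2 (fun j hj h3 h4 => ?_) a
      have := hsep i hi j hj h1 h2 (h1.trans h3) h4
      subst this
      exact lt_irrefl _ h3
    have e2 := run_eq_update (U := walkStep δ) (ev := fun i => e i ω) hl.pairwise hl.nodup hi h1
      (fun j hj h3 h4 => (hsep i hi j hj h1 h2 h3 (h4.trans h2)).symm) a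
    rw [e1, e2, hw, walkStep]
    by_cases hbi : bond (e i ω) = w
    · have : {j | e j ω ∈ window w s s'} = {i} := by
        ext j
        simp only [Set.mem_ofPred_eq, Set.mem_singleton_iff]
        refine ⟨fun hj => ?_, ?_⟩
        · have hj' := (hmem j).1 hj
          exact (hsep i hi j (hin j hj) h1 h2 hj'.1.1 hj'.1.2).symm
        · rintro rfl
          exact (hmem j).2 ⟨⟨h1, h2⟩, hbi⟩
      rw [if_pos hbi, count, this]
      simp
    · have : {j | e j ω ∈ window w s s'} = ∅ := by
        refine Set.eq_empty_of_forall_notMem fun j hj => hbi ?_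
        have hj' := (hmem j).1 hj
        rw [hsep i hi j (hin j hj) h1 h2 hj'.1.1 hj'.1.2]
        exact hj'.2
      rw [if_neg hbi, count, this]
      simp
  · have : {j | e j ω ∈ window w s s'} = ∅ :=
      Set.eq_empty_of_forall_notMem fun j hj => hex ⟨j, hin j hj, ((hmem j).1 hj).1⟩
    rw [count, this, run_eq_of_forall_not hl.pairwise hs
      (fun i hi h1 h2 => hex ⟨i, hi, h1, h2⟩), hw]
    simp

theorem IsBlockList.run_walkStep_mem {ev : ℕ → Event} (hv : ∀ i, IsValid (ev i)) {δ : ℤ}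
    (hδ : |δ| ≤ 1) {T : ℝ} {A B : ℤ} {l : List ℕ} (hl : IsBlockList ev T A B l) {a : ℤ}
    (hA : A ≤ a) (hB : a ≤ B) (s : ℝ) :
    A ≤ run (walkStep δ) ev l s a ∧ run (walkStep δ) ev l s a ≤ B :=
  run_induction (fun x : ℤ => A ≤ x ∧ x ≤ B) (fun i hi _ x hx =>
    have hbi := ((hl.mem_iff i).1 hi).1
    ((isLocal_walkStep hδ A B).inner _ (hv i) hbi.1 hbi.2 x x ⟨rfl, hx⟩).2) ⟨hA, hB⟩

/-- The finitely many events of a block have a positive minimal time gap. Slots have length at most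
`t K / m`, so for large `m` each contains at most one of them. -/
theorem IsRegular.eventually_gridWalk_eq {Ω : Type*} {e : ℕ → Ω → Event} {ω : Ω}
    (h : IsRegular fun i => e i ω) {δ : ℤ} (hδ : |δ| ≤ 1) (a : ℤ) {t : ℕ → ℝ≥0}
    (ht : Monotone t) (h0 : t 0 = 0) (K : ℕ) :
    ∀ᶠ m in atTop, ∀ q ≤ K, gridWalk e δ a (subdivision t m) ω (q * m) =
      walkPath δ (fun i => e i ω) a (t q) := by
  obtain ⟨A, B, hA, hB, hb⟩ := h.exists_block (t K) a a
  obtain ⟨l, hl, -⟩ := h.exists_isBlockList (t K) A B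
  have hsep : ∀ᶠ m : ℕ in atTop, ∀ i ∈ {i | i ∈ l}, ∀ j ∈ {j | j ∈ l}, i ≠ j →
      (t K : ℝ) / m < |(e i ω).1 - (e j ω).1| := by
    refine (eventually_all_finite (List.finite_toSet l)).2 fun i _ =>
      (eventually_all_finite (List.finite_toSet l)).2 fun j _ => ?_
    by_cases hij : i = j
    · exact Eventually.of_forall fun m hne => absurd hij hne
    · have hpos : 0 < |(e i ω).1 - (e j ω).1| :=
        abs_pos.2 (sub_ne_zero.2 fun heq => hij (h.inj i j heq))
      filter_upwards [(tendsto_const_div_atTop_nhds_zero_nat (t K : ℝ)).eventually_lt_const hpos]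
        with m hm _
      exact hm
  filter_upwards [hsep, eventually_gt_atTop 0] with m hm hm0 q hq
  have hle : ∀ j ≤ K * m, subdivision t m j ≤ t K := fun j hj => by
    rw [← subdivision_mul ht h0 hm0 K]
    exact monotone_subdivision t m hj
  have key : ∀ j ≤ K * m, gridWalk e δ a (subdivision t m) ω j =
      run (walkStep δ) (fun i => e i ω) l (subdivision t m j) a := by
    intro j
    induction j with
    | zero =>
      intro _
      have : subdivision t m 0 = 0 := by simp [subdivision]
      rw [this, NNReal.coe_zero, run_zero h.valid]
      rfl
    | succ j ih =>
      intro hj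
      have hin := hl.run_walkStep_mem h.valid hδ hA hB (subdivision t m j)
      rw [← ih (by omega)] at hin
      refine (h.run_walkStep_slot δ hb hl (by exact_mod_cast monotone_subdivision t m j.le_succ)
        (by exact_mod_cast hle (j + 1) hj) ?_ (ih (by omega)).symm hin.1 hin.2).symm
      intro i hi i' hi' h1 h2 h3 h4
      by_contra hne
      have h5 := hm i hi i' hi' hne
      have h6 : (subdivision t m (j + 1) : ℝ) ≤ subdivision t m j + t K / m := by
        exact_mod_cast subdivision_succ_sub_le ht (Nat.lt_of_succ_le hj)
      rw [lt_abs] at h5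
      rcases h5 with h5 | h5 <;> linarith
  rw [key (q * m) (Nat.mul_le_mul_right m hq), subdivision_mul ht h0 hm0]
  exact (h.walkPath_eq hδ hb hl hA hB (by exact_mod_cast ht hq)).symm

theorem IsRegular.walkPath_monotone {ev : ℕ → Event} (h : IsRegular ev) {δ : ℤ} (hδ : |δ| = 1)
    (a : ℤ) : Monotone fun s => δ * (walkPath δ ev a s - a) := by
  intro s s' hs
  have hδ2 : δ * δ = 1 := by rw [← abs_mul_abs_self, hδ, one_mul]
  obtain ⟨n, h1, h2⟩ := ((h.eventually_run_eq_walkPath hδ.le a s).and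
    (h.eventually_run_eq_walkPath hδ.le a s')).exists
  simp only
  rw [← h1, ← h2, run_split (labels_pairwise ev n) (s := s) (t := s') (by exact_mod_cast hs)]
  refine run_induction (fun x : ℤ => δ * (run (walkStep δ) ev (labels ev n) s a - a) ≤ δ * (x - a))
    (fun i _ _ x hx => hx.trans ?_) le_rfl
  unfold walkStep
  split_ifs <;> linarith

/-- Limits of measurable discrete sequences, on a measurable set where they stabilize. -/
theorem measurable_ite_of_eventually_eq {Ω E : Type*} [MeasurableSpace Ω] [TopologicalSpace E]
    [TopologicalSpace.PseudoMetrizableSpace E] [MeasurableSpace E] [BorelSpace E] {G : Set Ω}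
    [DecidablePred (· ∈ G)] (hG : MeasurableSet G) {f : ℕ → Ω → E} {F : Ω → E}
    (hf : ∀ n, Measurable (f n)) (h : ∀ ω ∈ G, ∀ᶠ n in atTop, f n ω = F ω) (c : E) :
    Measurable fun ω => if ω ∈ G then F ω else c := by
  refine measurable_of_tendsto_metrizable (f := fun n ω => if ω ∈ G then f n ω else c)
    (fun n => Measurable.ite hG (hf n) measurable_const) (tendsto_pi_nhds.2 fun ω => ?_)
  by_cases hω : ω ∈ G
  · simp only [hω, if_true]
    exact tendsto_const_nhds.congr' ((h ω hω).mono fun _ h => h.symm)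
  · simp only [hω, if_false]
    exact tendsto_const_nhds

open Classical in
/-- The number of steps of the walk, on a set `G` of regular realizations. -/
def walkCount {Ω : Type*} (e : ℕ → Ω → Event) (G : Set Ω) (δ a : ℤ) (s : ℝ≥0) (ω : Ω) : ℕ :=
  if ω ∈ G then (walkPath δ (fun i => e i ω) a s - a).natAbs else 0

theorem walkCount_of_mem {Ω : Type*} {e : ℕ → Ω → Event} {G : Set Ω} {ω : Ω} (hω : ω ∈ G) (hreg : IsRegular fun i => e i ω)
    {δ : ℤ} (hδ : |δ| = 1) (a : ℤ) (s : ℝ≥0) :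
    (walkCount e G δ a s ω : ℤ) = δ * (walkPath δ (fun i => e i ω) a s - a) := by
  have hmono := hreg.walkPath_monotone hδ a (zero_le : 0 ≤ s)
  have h0 : walkPath δ (fun i => e i ω) a 0 = a := (hreg.isRunPath_walkPath hδ.le a).zero hreg
  simp only [h0, sub_self, mul_zero] at hmono
  rw [walkCount, if_pos hω, Int.natCast_natAbs, ← abs_of_nonneg hmono, abs_mul, hδ, one_mul]

variable {Ω : Type*} [MeasurableSpace Ω] {P : Measure Ω} {p : ℝ} {e : ℕ → Ω → Event}

namespace IsHarrisSystem

theorem measurable_walkCount (he : IsHarrisSystem p e P) {G : Set Ω} (hG : MeasurableSet G)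
    (hreg : ∀ ω ∈ G, IsRegular fun i => e i ω) {δ : ℤ} (hδ : |δ| = 1) (a : ℤ) (s : ℝ≥0) :
    Measurable (walkCount e G δ a s) := by
  classical
  refine measurable_ite_of_eventually_eq hG (f := fun n ω =>
    (run (walkStep δ) (fun i => e i ω) (labels (fun i => e i ω) n) s a - a).natAbs)
    (fun n => ?_) (fun ω hω => ?_) 0
  · exact (Measurable.of_discrete (f := fun k : ℤ => (k - a).natAbs)).comp
      (measurable_run_labels he.measurable (measurable_walkStep δ) n s measurable_const)
  · filter_upwards [(hreg ω hω).eventually_run_eq_walkPath hδ.le a s] with n hn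
    rw [hn]

/-- The increments of the grid walk have the same product law for every `m`, and for large `m` they
equal those of the true walk; the law passes to the limit. -/
theorem map_walkCount_sub [IsProbabilityMeasure P] (he : IsHarrisSystem p e P) (hp0 : 0 ≤ p)
    (hp1 : p ≤ 1) {G : Set Ω} (hG : MeasurableSet G) (hreg : ∀ ω ∈ G, IsRegular fun i => e i ω)
    (hPG : ∀ᵐ ω ∂P, ω ∈ G) {δ : ℤ} (hδ : |δ| = 1) (a : ℤ) {t : ℕ → ℝ≥0} (ht : Monotone t)
    (h0 : t 0 = 0) (n : ℕ) :
    P.map (fun ω (q : Fin n) => walkCount e G δ a (t (q + 1)) ω - walkCount e G δ a (t q) ω) =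
      Measure.pi fun q : Fin n => poissonMeasure (t (q + 1) - t q) := by
  have hN := he.measurable_walkCount hG hreg hδ a
  refine map_eq_of_eventually_eq
    (Y := fun m ω (q : Fin n) => gridIncrement e δ a t (m + 1) q ω)
    (fun m => measurable_pi_iff.2 fun q => Finset.measurable_fun_sum _ fun r _ =>
      he.measurable_gridStep δ a _ _)
    (measurable_pi_iff.2 fun q => (hN _).sub (hN _))
    (fun m => he.map_gridIncrement hp0 hp1 δ a ht h0 m.succ_pos n) ?_
  filter_upwards [hPG] with ω hω
  have hev := (hreg ω hω).eventually_gridWalk_eq hδ.le a ht h0 n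
  filter_upwards [(tendsto_add_atTop_nat 1).eventually hev] with m hm
  have hsum : ∀ q ≤ n, walkCount e G δ a (t q) ω =
      ∑ j ∈ Finset.range (q * (m + 1)), gridStep e δ a (subdivision t (m + 1)) j ω := by
    intro q hq
    have hδ2 : δ * δ = 1 := by rw [← abs_mul_abs_self, hδ, one_mul]
    have h1 := walkCount_of_mem hω (hreg ω hω) hδ a (t q)
    rw [← hm q hq, gridWalk_eq, add_sub_cancel_left, ← mul_assoc, hδ2, one_mul] at h1
    exact_mod_cast h1
  funext q
  show _ = walkCount e G δ a (t (q + 1)) ω - walkCount e G δ a (t q) ω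
  rw [hsum (q + 1) (Nat.succ_le_of_lt q.2), hsum _ q.2.le, Nat.succ_mul, Finset.sum_range_add,
    Nat.add_sub_cancel_left]
  rfl

/-- The walks that step at every event on their bond are Poisson processes with rate one. -/
theorem isPoissonProcess_walkCount [IsProbabilityMeasure P] (he : IsHarrisSystem p e P)
    (hp0 : 0 ≤ p) (hp1 : p ≤ 1) {G : Set Ω} (hG : MeasurableSet G)
    (hreg : ∀ ω ∈ G, IsRegular fun i => e i ω) (hPG : ∀ᵐ ω ∂P, ω ∈ G) {δ : ℤ} (hδ : |δ| = 1)
    (a : ℤ) : IsPoissonProcess (walkCount e G δ a) 1 P := by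
  have hN := he.measurable_walkCount hG hreg hδ a
  have hincr : ∀ (t : ℕ → ℝ≥0), Monotone t → t 0 = 0 → ∀ n : ℕ, _ := fun t ht h0 n =>
    iIndepFun_and_map_of_map_eq_pi (fun q : Fin n => (hN (t (q + 1))).sub (hN (t q)))
      (he.map_walkCount_sub hp0 hp1 hG hreg hPG hδ a ht h0 n)
  -- Time `0` is prepended because the grid must start there; the resulting extra first increment is
  -- dropped below by shifting the index.
  let cons (t : ℕ → ℝ≥0) : ℕ → ℝ≥0 := fun n => Nat.casesOn n 0 t
  have hcons : ∀ t : ℕ → ℝ≥0, Monotone t → Monotone (cons t) := fun t ht =>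
    monotone_nat_of_le_succ fun n => by
      cases n with
      | zero => exact zero_le
      | succ n => exact ht n.le_succ
  refine ⟨hN, ?_, ?_, ?_, ?_, ?_⟩
  · filter_upwards [hPG] with ω hω
    rw [walkCount, if_pos hω, ((hreg ω hω).isRunPath_walkPath hδ.le a).zero (hreg ω hω)]
    simp
  · filter_upwards [hPG] with ω hω s s' hs
    have := (hreg ω hω).walkPath_monotone hδ a hs
    simp only [← walkCount_of_mem hω (hreg ω hω) hδ a] at this
    exact_mod_cast this
  · filter_upwards [hPG] with ω hω
    have := (((hreg ω hω).isRunPath_walkPath hδ.le a).isPiecewiseConst (hreg ω hω)).comp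
      (fun x => (x - a).natAbs)
    simp only [walkCount, if_pos hω]
    exact this.isCadlag
  · refine HasIndepIncrements.of_nat fun t ht _ => ?_
    have h1 := iIndepFun_of_forall_fin (P := P)
      (X := fun i ω => walkCount e G δ a (cons t (i + 1)) ω - walkCount e G δ a (cons t i) ω)
      fun n => (hincr (cons t) (hcons t ht) rfl n).1
    exact h1.precomp (g := Nat.succ) Nat.succ_injective
  · intro s s' hs
    let t : ℕ → ℝ≥0 := fun n => Nat.casesOn n s fun _ => s'
    have ht : Monotone t := monotone_nat_of_le_succ fun n => by
      cases n with
      | zero => exact hs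
      | succ n => exact le_rfl
    have h1 := (hincr (cons t) (hcons t ht) rfl 2).2 1
    rw [one_mul]
    exact h1

end IsHarrisSystem

end PoissonWalk

/-! ### Riemann initial data and the final assembly -/

theorem isInterface_riemannConfig {ξl ξ ξr : Config} (hl : ξl ≤ ξ) (hr : ξ ≤ ξr) (a : ℤ) :
    IsInterface (riemannConfig ξl ξr a) ξ a := by
  constructor
  · intro y hy
    rw [riemannConfig, if_pos hy]
    exact hl y
  · intro y hy
    rw [riemannConfig, if_neg (not_le.2 hy)]
    exact hr y

theorem measurable_riemannConfig {Ω : Type*} [MeasurableSpace Ω] {ξl ξr : Ω → Config}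
    (hl : Measurable ξl) (hr : Measurable ξr) (a : ℤ) :
    Measurable fun ω => riemannConfig (ξl ω) (ξr ω) a := by
  refine measurable_pi_iff.2 fun y => ?_
  unfold riemannConfig
  by_cases hy : y ≤ a
  · simp only [if_pos hy]
    exact measurable_pi_iff.1 hl y
  · simp only [if_neg hy]
    exact measurable_pi_iff.1 hr y

end ZeroRange

end

theorem proposition4p7 {Ω : Type*} [MeasurableSpace Ω] (P : Measure Ω) [IsProbabilityMeasure P]
    (p : ℝ) (hp : 1 / 2 < p) (hp' : p ≤ 1)
    (g : ℕ → ℝ) (hg : ZeroRange.IsJumpRate g)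
    (α : ℤ → ℝ) (hα : ∀ x, α x ∈ Set.Icc (0 : ℝ) 1)
    (e : ℕ → Ω → ZeroRange.Event) (he : ZeroRange.IsHarrisSystem p e P)
    (ξ₀ : ℝ≥0 → Ω → ZeroRange.Config) (hξ₀ : ZeroRange.IsPseudoEquilibriumFamily ξ₀ P)
    (lam rho : ℝ≥0) (hlr : lam ≤ rho) (u t : ℝ) (ht : 0 ≤ t) :
    -- the Harris flow is almost surely well defined, for all initial configurations
    (∀ᵐ ω ∂P, ∀ η₀ : ZeroRange.Config,
      ∃! η, ZeroRange.IsHarrisPath α g (ZeroRange.events e ω) η₀ η) ∧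
    ∃ X : Set.Icc lam rho → ℝ≥0 → Ω → ℤ,
      (∀ (r : Set.Icc lam rho) (s : ℝ≥0), Measurable (X r s)) ∧
      (∀ᵐ ω ∂P,
        (∀ r : Set.Icc lam rho, X r 0 ω = ⌊u * t⌋) ∧
        (∀ (r : Set.Icc lam rho) (s : ℝ≥0), ZeroRange.IsInterface
          (ZeroRange.flow α g (ZeroRange.events e ω)
            (ZeroRange.riemannConfig (ξ₀ lam ω) (ξ₀ rho ω) ⌊u * t⌋) s)
          (ZeroRange.flow α g (ZeroRange.events e ω) (ξ₀ r ω) s)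
          (X r s ω)) ∧
        (∀ r : Set.Icc lam rho, ZeroRange.IsNearestNeighbourPath fun s => X r s ω) ∧
        (∀ r r' : Set.Icc lam rho, r ≤ r' → ∀ s : ℝ≥0, X r s ω ≤ X r' s ω)) ∧
      (∀ r : Set.Icc lam rho, ∃ Nplus Nminus : ℝ≥0 → Ω → ℕ,
        ZeroRange.IsPoissonProcess Nplus 1 P ∧ ZeroRange.IsPoissonProcess Nminus 1 P ∧
        ∀ᵐ ω ∂P, ∀ s : ℝ≥0, -(Nminus s ω : ℤ) ≤ X r s ω - X r 0 ω ∧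
          X r s ω - X r 0 ω ≤ (Nplus s ω : ℤ)) := by
  classical
  have hp0 : 0 ≤ p := by linarith
  have hα0 : ∀ x, 0 ≤ α x := fun x => (hα x).1
  have hae := he.ae_isRegular hp0 hp'
  -- A single measurable set of full measure serves the uncountable family of densities, since the
  -- order of the initial data holds on it for all pairs simultaneously.
  obtain ⟨G, hPG, hG, hGsub⟩ := (hae.and hξ₀.ordered).exists_measurable_mem
  have hreg : ∀ ω ∈ G, ZeroRange.IsRegular fun i => e i ω := fun ω hω => (hGsub ω hω).1
  set a : ℤ := ⌊u * t⌋
  let η₀ : Ω → ZeroRange.Config := fun ω => ZeroRange.riemannConfig (ξ₀ lam ω) (ξ₀ rho ω) a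
  have hint : ∀ ω ∈ G, ∀ r : Set.Icc lam rho, ZeroRange.IsInterface (η₀ ω) (ξ₀ r ω) a :=
    fun ω hω r => ZeroRange.isInterface_riemannConfig ((hGsub ω hω).2 _ _ r.2.1)
      ((hGsub ω hω).2 _ _ r.2.2) a
  -- Outside `G` the runs need not stabilize; the constant value `a` there keeps the process
  -- measurable.
  let X : Set.Icc lam rho → ℝ≥0 → Ω → ℤ := fun r s ω =>
    if ω ∈ G then ZeroRange.interfacePath α g (fun i => e i ω) (η₀ ω) (ξ₀ r ω) a s else a
  have hX : ∀ r s, ∀ ω ∈ G, X r s ω =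
      ZeroRange.interfacePath α g (fun i => e i ω) (η₀ ω) (ξ₀ r ω) a s :=
    fun r s ω hω => if_pos hω
  have hX0 : ∀ r, ∀ ω ∈ G, X r 0 ω = a := fun r ω hω => by
    rw [hX r 0 ω hω]
    exact ((hreg ω hω).isRunPath_interfacePath _ _ a).zero (hreg ω hω)
  refine ⟨hae.mono fun ω hω η₀ => hω.existsUnique_isHarrisPath η₀, X, fun r s => ?_, ?_, fun r => ?_⟩
  · refine ZeroRange.measurable_ite_of_eventually_eq hG
      (fun n => (ZeroRange.measurable_run_labels he.measurable
        (ZeroRange.measurable_interfaceStep α g) n s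
        ((ZeroRange.measurable_riemannConfig (hξ₀.measurable lam) (hξ₀.measurable rho) a).prodMk
          ((hξ₀.measurable r).prodMk measurable_const))).snd.snd)
      (fun ω hω => (hreg ω hω).eventually_run_eq_interfacePath _ _ a s) a
  · filter_upwards [hPG] with ω hω
    have hω' := hreg ω hω
    refine ⟨fun r => hX0 r ω hω, fun r s => ?_, fun r => ?_, fun r r' hrr s => ?_⟩
    · rw [hX r s ω hω, ZeroRange.events, hω'.flow_eq, hω'.flow_eq]
      exact hω'.isInterface_interfacePath hg hα0 (hint ω hω r) s
    · simp only [hX r _ ω hω]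
      exact (hω'.isRunPath_interfacePath _ _ a).isNearestNeighbourPath hω'
        ZeroRange.abs_interfaceStep_sub_le
    · rw [hX r s ω hω, hX r' s ω hω]
      exact hω'.interfacePath_mono hg hα0 (hint ω hω r) (hint ω hω r')
        ((hGsub ω hω).2 _ _ hrr) s
  · refine ⟨ZeroRange.walkCount e G 1 a, ZeroRange.walkCount e G (-1) a,
      he.isPoissonProcess_walkCount hp0 hp' hG hreg hPG (by simp) a,
      he.isPoissonProcess_walkCount hp0 hp' hG hreg hPG (by simp) a, ?_⟩
    filter_upwards [hPG] with ω hω s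
    rw [hX0 r ω hω, hX r s ω hω, ZeroRange.walkCount_of_mem hω (hreg ω hω) (by simp),
      ZeroRange.walkCount_of_mem hω (hreg ω hω) (by simp)]
    have h1 := (hreg ω hω).interfacePath_le_walkPath (α := α) (g := g) (η₀ ω) (ξ₀ r ω) a s
    have h2 := (hreg ω hω).walkPath_le_interfacePath (α := α) (g := g) (η₀ ω) (ξ₀ r ω) a s
    constructor <;> linarith
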